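/- Let $\pi\in S_3$ be a pattern of three letters. A word $w_1w_2\cdots w_m$ over a totally ordered alphabet contains $\pi$ if there are positions $p_1<p_2<p_3$ such that $w_{p_1},w_{p_2},w_{p_3}$ are distinct and in the same relative order as $\pi(1),\pi(2),\pi(3)$; otherwise it avoids $\pi$. Let $c(n)$ be the number of $\pi$-avoiding compositions of $n$ into positive parts (with $c(0)=1$), let $c(n,k)$ be the number of those whose parts are all $\le k$, and let $f(x)=\sum_{n\ge 0}c(n)x^n$ and $f_k(x)=\sum_{n\ge0}c(n,k)x^n$ in $\mathbb Q[[x]]$. (1) In the field $\mathbb Q((x))$ of formal Laurent series, with its $x$-adic topology, $$f(x)=\sum_{i\ge 1}\frac{1}{1-x^i}\prod_{j\ge 1,\ j\neq i}\frac{1-x^i}{(1-x^{j-i})(1-x^i-x^j)},$$ where all the infinite products and the infinite sum converge unconditionally. (2) For every $k\ge 1$ let $G_k(x_1,\dots,x_k)$ be the formal power series in which the coefficient of $x_1^{a_1}\cdots x_k^{a_k}$ ($a_1,\dots,a_k\ge 0$) is the number of $\pi$-avoiding permutations of the multiset $1^{a_1}2^{a_2}\cdots k^{a_k}$. Then, in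 the fraction field of $\mathbb Q[[x_1,\dots,x_k]]$, $G_k$ equals $$g_k(x_1,\dots,x_k)=\sum_{i=1}^k\frac{x_i^{k-1}(1-x_i)^{k-2}}{\prod_{1\le j\le k,\ j\ne i}(x_i-x_j)(1-x_i-x_j)},$$ and the generating function for parts $\le k$ is obtained from it by the substitution $x_i=x^i$: $$f_k(x)=G_k(x,x^2,\dots,x^k)=g_k(x,x^2,\dots,x^k).$$ Equivalently, $f_k$ is given by the formula in (1) with both indices $i$ and $j$ halted at $k$: $$f_k(x)=\sum_{i=1}^k\frac{1}{1-x^i}\prod_{1\le j\le k,\ j\neq i}\frac{1-x^i}{(1-x^{j-i})(1-x^i-x^j)}.$$ Moreover $f$ and $f_k$ have the same coefficient of $x^n$ for all $n\le k$. -/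

import Mathlib

open scoped PowerSeries LaurentSeries

/-- The word `l` contains the three-letter pattern `π` (in one-line notation `π 0, π 1, π 2`): there are
positions `e 0 < e 1 < e 2` at which the letters of `l` are distinct and in the same relative order
as `π 0, π 1, π 2`. -/
def ContainsPattern {α : Type*} [LinearOrder α] (π : Equiv.Perm (Fin 3)) (l : List α) : Prop :=
  ∃ e : Fin 3 → Fin l.length, StrictMono e ∧
    ∀ a b : Fin 3, l.get (e a) < l.get (e b) ↔ π a < π b

/-- The word `l` avoids the pattern `π`. -/
def AvoidsPattern {α : Type*} [LinearOrder α] (π : Equiv.Perm (Fin 3)) (l : List α) : Prop :=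
  ¬ ContainsPattern π l

/-- The number of `π`-avoiding compositions of `n` into positive parts. -/
noncomputable def avoidCount (π : Equiv.Perm (Fin 3)) (n : ℕ) : ℕ :=
  Nat.card {c : Composition n // AvoidsPattern π c.blocks}

/-- The number of `π`-avoiding compositions of `n` into positive parts that are all at most `k`. -/
noncomputable def avoidCountLE (π : Equiv.Perm (Fin 3)) (k n : ℕ) : ℕ :=
  Nat.card {c : Composition n // (∀ p ∈ c.blocks, p ≤ k) ∧ AvoidsPattern π c.blocks}

/-- The number of `π`-avoiding permutations of the multiset that contains `a i` copies of each letter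
`i`. The letters are `0, …, k - 1` in place of `1, …, k`. -/
noncomputable def multisetAvoidCount (k : ℕ) (π : Equiv.Perm (Fin 3)) (a : Fin k →₀ ℕ) : ℕ :=
  Nat.card {l : List (Fin k) // (∀ i, l.count i = a i) ∧ AvoidsPattern π l}

/-- The ordinary generating function of the `π`-avoiding compositions. -/
noncomputable def compGF (π : Equiv.Perm (Fin 3)) : ℚ⟦X⟧ :=
  PowerSeries.mk fun n => (avoidCount π n : ℚ)

/-- The ordinary generating function of the `π`-avoiding compositions with parts at most `k`. -/
noncomputable def compGFLE (π : Equiv.Perm (Fin 3)) (k : ℕ) : ℚ⟦X⟧ :=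
  PowerSeries.mk fun n => (avoidCountLE π k n : ℚ)

/-- The generating function, in `k` variables, of the numbers of `π`-avoiding multiset permutations. -/
noncomputable def multisetGF (k : ℕ) (π : Equiv.Perm (Fin 3)) : MvPowerSeries (Fin k) ℚ :=
  fun a => (multisetAvoidCount k π a : ℚ)

/-- The rational expression
`g_k(x) = ∑ i, x_i ^ (k - 1) (1 - x_i) ^ (k - 2) / ∏ j ≠ i, (x_i - x_j) (1 - x_i - x_j)`
evaluated in a field. The exponent `k - 2` is an integer (it is `-1` for `k = 1`). -/
noncomputable def gRat {K : Type*} [Field K] (k : ℕ) (x : Fin k → K) : K :=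
  ∑ i, x i ^ (k - 1) * (1 - x i) ^ ((k : ℤ) - 2) /
    ∏ j ∈ Finset.univ.erase i, ((x i - x j) * (1 - x i - x j))

/-- The indeterminate `x` in the field of formal Laurent series over `ℚ`. -/
noncomputable def xL : ℚ⸨X⸩ := HahnSeries.single (1 : ℤ) (1 : ℚ)

/-- The factor `(1 - x ^ i) / ((1 - x ^ (j - i)) (1 - x ^ i - x ^ j))`, a formal Laurent series. -/
noncomputable def gfFactor (i j : ℕ) : ℚ⸨X⸩ :=
  (1 - xL ^ i) / ((1 - xL ^ ((j : ℤ) - (i : ℤ))) * (1 - xL ^ i - xL ^ j))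

/-! Words are counted by content, and the patterns `123` and `132` are treated together: avoidance
means that after every letter the larger letters form a weakly decreasing, respectively weakly
increasing, word (`LargerSorted`). Put y_i = x_i(1 - x_i), and let F_S be the generating function of
such words over an alphabet S. If q < p are the two smallest letters and T is the set of the others,
then (y_p - y_q) F_{p,q,T} = y_p F_{p,T} - y_q F_{q,T}, because (x_p - x_q)(1 - x_p - x_q) = y_p -
y_q. This is `mul_wordGF_largerSortedWords`.

The relation already holds for each fixed word w formed by the letters above p
(`mul_wordGF_shuffles_pair`), by induction on w through the first letter of the whole word. A small
letter can stand in front only if w is sorted. If that letter is q, what follows is a word whose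
letters above q are sorted; this auxiliary class is the only point at which the two patterns need
different arguments (`mul_wordGF_sortedShuffles_le`, `mul_wordGF_sortedShuffles_ge`), yet both give
the same series.

The sum of (1 - x_i)⁻¹ ∏_{j ≠ i} y_i / (y_i - y_j) satisfies the same divided-difference recurrence
and has the same value on one letter, so it equals F_S. It is symmetric in the letters, hence
reversing words or the alphabet carries it to the remaining patterns. The recurrence is solved in
any field that receives the power series with distinct images of the y_i; this covers both the
fraction field and the Laurent series after x_i = x^i, where substituting into the separate
fractions would need justification.

For the infinite formula, the truncation at k is exact for parts at most k, and f and f_k agree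
through degree k. The factor with j > i differs from 1 by order at least j - i, and the i-th product
has order at least i - 1. Together these put the truncated and the infinite expression within x^k of
each other, so the infinite sum converges to f. -/

/-! ### Generating functions of sets of words by content -/

section WordSeries

variable {σ : Type*}

/-- The generating function of a set of words: the coefficient of a monomial is the number of words of
the set with that content. -/
noncomputable def wordGF (A : Set (List σ)) : MvPowerSeries σ ℚ :=
  fun e => ({l : List σ | l ∈ A ∧ (l : Multiset σ) = Finsupp.toMultiset e}.ncard : ℚ)

theorem coeff_wordGF (A : Set (List σ)) (e : σ →₀ ℕ) :
    MvPowerSeries.coeff e (wordGF A) =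
      ({l : List σ | l ∈ A ∧ (l : Multiset σ) = Finsupp.toMultiset e}.ncard : ℚ) := rfl

theorem finite_setOf_coe_eq (s : Multiset σ) : {l : List σ | (l : Multiset σ) = s}.Finite := by
  induction s using Quotient.inductionOn with
  | h l₀ =>
    refine (List.finite_toSet l₀.permutations).subset fun l hl => ?_
    simpa [List.mem_permutations] using hl

theorem finite_setOf_mem_and_coe_eq (A : Set (List σ)) (s : Multiset σ) :
    {l : List σ | l ∈ A ∧ (l : Multiset σ) = s}.Finite :=
  (finite_setOf_coe_eq s).subset fun _ h => h.2

theorem wordGF_empty : wordGF (∅ : Set (List σ)) = 0 := by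
  ext e; simp [coeff_wordGF]

theorem wordGF_nil : wordGF ({[]} : Set (List σ)) = 1 := by
  classical
  ext e
  rw [coeff_wordGF, MvPowerSeries.coeff_one]
  split_ifs with h
  · subst h
    have : {l : List σ | l ∈ ({[]} : Set (List σ)) ∧ (l : Multiset σ) = Finsupp.toMultiset 0}
        = {[]} := by ext l; simp
    rw [this]; simp
  · have : {l : List σ | l ∈ ({[]} : Set (List σ)) ∧ (l : Multiset σ) = Finsupp.toMultiset e}
        = ∅ := by
      ext l
      simp only [Set.mem_singleton_iff, Set.mem_ofPred_eq, Set.mem_empty_iff_false, iff_false]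
      rintro ⟨rfl, h2⟩
      exact h (Finsupp.ext fun a => by
        rw [← Finsupp.count_toMultiset, ← h2]; simp)
    rw [this]; simp

theorem wordGF_union {A B : Set (List σ)} (h : Disjoint A B) :
    wordGF (A ∪ B) = wordGF A + wordGF B := by
  ext e
  rw [map_add, coeff_wordGF, coeff_wordGF, coeff_wordGF, ← Nat.cast_add,
    ← Set.ncard_union_eq _ (finite_setOf_mem_and_coe_eq _ _) (finite_setOf_mem_and_coe_eq _ _)]
  · congr 2
    ext l
    simp [or_and_right]
  · exact Set.disjoint_left.2 fun l h1 h2 => Set.disjoint_left.1 h h1.1 h2.1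

theorem wordGF_cons (x : σ) (A : Set (List σ)) :
    wordGF (List.cons x '' A) = MvPowerSeries.X x * wordGF A := by
  classical
  ext e
  rw [MvPowerSeries.X, MvPowerSeries.coeff_monomial_mul, coeff_wordGF]
  split_ifs with h
  · rw [one_mul, coeff_wordGF, ← Set.ncard_image_of_injective
      {l | l ∈ A ∧ (l : Multiset σ) = Finsupp.toMultiset (e - Finsupp.single x 1)}
      (List.cons_injective (a := x))]
    congr 2
    ext l
    have he : Finsupp.toMultiset e = x ::ₘ Finsupp.toMultiset (e - Finsupp.single x 1) := by
      conv_lhs => rw [← add_tsub_cancel_of_le h]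
      simp
    simp only [Set.mem_ofPred_eq, Set.mem_image]
    constructor
    · rintro ⟨⟨l', h1, rfl⟩, h2⟩
      refine ⟨l', ⟨h1, ?_⟩, rfl⟩
      rw [he, ← Multiset.cons_coe, Multiset.cons_inj_right] at h2
      exact h2
    · rintro ⟨l', ⟨h1, h2⟩, rfl⟩
      exact ⟨⟨l', h1, rfl⟩, by rw [he, ← Multiset.cons_coe, h2]⟩
  · have : {l : List σ | l ∈ List.cons x '' A ∧ (l : Multiset σ) = Finsupp.toMultiset e} = ∅ := by
      ext l
      simp only [Set.mem_image, Set.mem_ofPred_eq, Set.mem_empty_iff_false, iff_false]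
      rintro ⟨⟨l', -, rfl⟩, h2⟩
      apply h
      rw [Finsupp.single_le_iff]
      have := congrArg (Multiset.count x) h2
      rw [Finsupp.count_toMultiset] at this
      rw [← this]
      simp
    rw [this]; simp

/-- Sorting words by their first letter. -/
theorem wordGF_eq_sum_cons (A : Set (List σ)) (S : Finset σ)
    (hS : ∀ x l, x :: l ∈ A → x ∈ S) :
    wordGF A = wordGF (A ∩ {[]}) + ∑ x ∈ S, MvPowerSeries.X x * wordGF {l | x :: l ∈ A} := by
  classical
  -- Induction over the set of allowed first letters; the empty word is never excluded.
  have key : ∀ T : Finset σ, wordGF {l | l ∈ A ∧ ∀ x l', l = x :: l' → x ∈ T} =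
      wordGF (A ∩ {[]}) + ∑ x ∈ T, MvPowerSeries.X x * wordGF {l | x :: l ∈ A} := by
    intro T
    induction T using Finset.induction_on with
    | empty =>
      rw [Finset.sum_empty, add_zero]
      congr 1
      ext l
      cases l <;> simp
    | insert a T ha ih =>
      rw [Finset.sum_insert ha, add_left_comm, ← ih, ← wordGF_cons, ← wordGF_union]
      · congr 1
        ext l
        cases l with
        | nil => simp
        | cons y l =>
          simp only [Set.mem_ofPred_eq, List.cons.injEq, Set.mem_union, Set.mem_image,
            Finset.mem_insert]
          constructor
          · rintro ⟨h1, h2⟩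
            rcases h2 y l ⟨rfl, rfl⟩ with rfl | h3
            · exact Or.inl ⟨l, h1, rfl, rfl⟩
            · exact Or.inr ⟨h1, by rintro _ _ ⟨rfl, rfl⟩; exact h3⟩
          · rintro (⟨l', h1, rfl, rfl⟩ | ⟨h1, h2⟩)
            · exact ⟨h1, by rintro _ _ ⟨rfl, rfl⟩; exact Or.inl rfl⟩
            · exact ⟨h1, by rintro _ _ ⟨rfl, rfl⟩; exact Or.inr (h2 _ _ ⟨rfl, rfl⟩)⟩
      · rw [Set.disjoint_left]
        rintro _ ⟨l, -, rfl⟩ ⟨-, h2⟩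
        exact ha (h2 _ _ rfl)
  rw [← key]
  congr 1
  ext l
  simp only [Set.mem_ofPred_eq]
  exact ⟨fun h => ⟨h, fun x l' hl => hS x l' (hl ▸ h)⟩, fun h => h.1⟩

theorem wordGF_eq_sum_cons_of_nil_mem {A : Set (List σ)} (S : Finset σ)
    (hS : ∀ x l, x :: l ∈ A → x ∈ S) (h : [] ∈ A) :
    wordGF A = 1 + ∑ x ∈ S, MvPowerSeries.X x * wordGF {l | x :: l ∈ A} := by
  rw [wordGF_eq_sum_cons A S hS, Set.inter_eq_right.2 (Set.singleton_subset_iff.2 h), wordGF_nil]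

theorem wordGF_eq_sum_cons_of_nil_notMem {A : Set (List σ)} (S : Finset σ)
    (hS : ∀ x l, x :: l ∈ A → x ∈ S) (h : [] ∉ A) :
    wordGF A = ∑ x ∈ S, MvPowerSeries.X x * wordGF {l | x :: l ∈ A} := by
  rw [wordGF_eq_sum_cons A S hS, Set.inter_singleton_eq_empty.2 h, wordGF_empty, zero_add]

/-- A coefficient of a multiple of a generating function, when the words are sorted by the value of a
map that does not increase the length. -/
theorem coeff_mul_wordGF_eq_sum (P : MvPowerSeries σ ℚ) (A : Set (List σ)) (f : List σ → List σ)
    (hf : ∀ l, (f l).length ≤ l.length) (e : σ →₀ ℕ) (W : Finset (List σ))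
    (hW : ∀ w : List σ, w.length ≤ Multiset.card (Finsupp.toMultiset e) → w ∈ W) :
    MvPowerSeries.coeff e (P * wordGF A) =
      ∑ w ∈ W, MvPowerSeries.coeff e (P * wordGF {l | l ∈ A ∧ f l = w}) := by
  classical
  simp_rw [MvPowerSeries.coeff_mul]
  rw [Finset.sum_comm]
  refine Finset.sum_congr rfl fun p hp => ?_
  rw [← Finset.mul_sum]
  congr 1
  simp_rw [coeff_wordGF]
  rw [← Nat.cast_sum, Nat.cast_inj]
  have hfin := finite_setOf_mem_and_coe_eq A (Finsupp.toMultiset p.2)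
  -- The content of l is part of e, so l and its image are short enough to lie in W. Only finitely
  -- many fibres therefore matter for one coefficient.
  have hmem : ∀ l ∈ hfin.toFinset, f l ∈ W := by
    intro l hl
    rw [Set.Finite.mem_toFinset] at hl
    apply hW
    refine (hf l).trans ?_
    have h2 : l.length = Multiset.card (Finsupp.toMultiset p.2) := by rw [← hl.2]; simp
    rw [h2, ← Finset.HasAntidiagonal.mem_antidiagonal.1 hp, map_add, Multiset.card_add]
    omega
  rw [Set.ncard_eq_toFinset_card _ hfin, Finset.card_eq_sum_card_fiberwise hmem]
  refine Finset.sum_congr rfl fun w _ => ?_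
  rw [← Set.ncard_coe_finset]
  congr 1
  ext l
  simp only [Finset.coe_filter, Set.Finite.mem_toFinset, Set.mem_ofPred_eq]
  tauto

end WordSeries

/-! ### Words with prescribed large letters: which first letters are possible -/

section Shuffles

variable {σ : Type*} [LinearOrder σ]

/-- For every letter, the larger letters after it form a word that is sorted with respect to `R`.
For `R = (≥)` this is avoidance of `123` and for `R = (≤)` it is avoidance of `132`. -/
def LargerSorted (R : σ → σ → Prop) : List σ → Prop
  | [] => True
  | a :: l => (l.filter (a < ·)).Pairwise R ∧ LargerSorted R l

theorem LargerSorted.filter {R : σ → σ → Prop} (p : σ → Bool) {l : List σ}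
    (h : LargerSorted R l) : LargerSorted R (l.filter p) := by
  induction l with
  | nil => trivial
  | cons a l ih =>
    rw [List.filter_cons]
    split_ifs
    · refine ⟨?_, ih h.2⟩
      rw [List.filter_filter]
      simp_rw [Bool.and_comm]
      rw [← List.filter_filter]
      exact h.1.filter _
    · exact ih h.2

/-- Above a lower bound b of all letters, the letters exceeding any given letter form a subword of
those exceeding b, so a single sortedness condition suffices. -/
theorem LargerSorted.of_pairwise {R : σ → σ → Prop} {b : σ} {l : List σ} (hb : ∀ a ∈ l, b ≤ a)
    (h : (l.filter (b < ·)).Pairwise R) : LargerSorted R l := by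
  induction l with
  | nil => trivial
  | cons a l ih =>
    refine ⟨?_, ih (fun x hx => hb x (List.mem_cons_of_mem _ hx)) ?_⟩
    · refine h.sublist ?_
      have h1 : l.filter (a < ·) = (l.filter (b < ·)).filter (a < ·) := by
        rw [List.filter_filter]
        refine List.filter_congr fun x _ => ?_
        have := hb a List.mem_cons_self
        by_cases hx : a < x
        · simp [hx, this.trans_lt hx]
        · simp [hx]
      rw [h1]
      exact List.filter_sublist.trans ((List.sublist_cons_self a l).filter _)
    · exact h.sublist ((List.sublist_cons_self a l).filter _)

/-- The words whose letters above `p` spell `w`, whose other letters are in `T`, and in which the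
larger letters after any letter are sorted. -/
def shuffles (R : σ → σ → Prop) (p : σ) (T : Finset σ) (w : List σ) : Set (List σ) :=
  {l | LargerSorted R l ∧ (∀ a ∈ l, a ≤ p → a ∈ T) ∧ l.filter (p < ·) = w}

/-- The words whose letters above `p` spell `w`, whose other letters are `p` and `q`, and whose letters
above `q` are sorted. -/
def sortedShuffles (R : σ → σ → Prop) (q p : σ) (w : List σ) : Set (List σ) :=
  {l | (l.filter (q < ·)).Pairwise R ∧ (∀ a ∈ l, a ≤ p → a ∈ ({p, q} : Finset σ)) ∧
    l.filter (p < ·) = w}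

variable {R : σ → σ → Prop} {p q : σ} {T : Finset σ}

theorem nil_mem_shuffles_iff {w : List σ} : [] ∈ shuffles R p T w ↔ w = [] := by
  simp [shuffles, LargerSorted, eq_comm]

theorem nil_mem_sortedShuffles_iff {w : List σ} : [] ∈ sortedShuffles R q p w ↔ w = [] := by
  simp [sortedShuffles, eq_comm]

theorem cons_mem_shuffles_of_lt {a α : σ} {w l : List σ} (ha : p < a)
    (h : LargerSorted R (α :: w)) (hw : p < α) :
    a :: l ∈ shuffles R p T (α :: w) ↔ a = α ∧ l ∈ shuffles R p T w := by
  simp only [shuffles, Set.mem_ofPred_eq, LargerSorted, List.forall_mem_cons, List.filter_cons,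
    ha, decide_true, if_true, List.cons.injEq]
  constructor
  · rintro ⟨⟨h1, h2⟩, ⟨-, h3⟩, rfl, h4⟩
    exact ⟨rfl, h2, h3, h4⟩
  · rintro ⟨rfl, h2, h3, h4⟩
    refine ⟨⟨?_, h2⟩, ⟨fun h => absurd ha h.not_gt, h3⟩, rfl, h4⟩
    -- The condition imposed by a large first letter involves only large letters, so it is a
    -- condition on the prescribed word and holds by assumption.
    have h1 : l.filter (a < ·) = w.filter (a < ·) := by
      rw [← h4, List.filter_filter]
      refine List.filter_congr fun x _ => ?_
      by_cases hx : a < x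
      · simp [hx, ha.trans hx]
      · simp [hx]
    rw [h1]
    exact h.1

theorem head_eq_of_cons_mem_shuffles {a α : σ} {w l : List σ}
    (h : a :: l ∈ shuffles R p T (α :: w)) : a ∈ insert α T := by
  rw [Finset.mem_insert]
  by_cases ha : p < a
  · have := h.2.2
    simp only [List.filter_cons, ha, decide_true, if_true, List.cons.injEq] at this
    exact Or.inl this.1
  · exact Or.inr (h.2.1 a List.mem_cons_self (not_lt.1 ha))

theorem head_mem_of_cons_mem_shuffles_nil {a : σ} {l : List σ}
    (h : a :: l ∈ shuffles R p T []) : a ∈ T := by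
  by_cases ha : p < a
  · have := h.2.2
    simp [ha] at this
  · exact h.2.1 a List.mem_cons_self (not_lt.1 ha)

theorem head_eq_of_cons_mem_sortedShuffles {a α : σ} {w l : List σ}
    (h : a :: l ∈ sortedShuffles R q p (α :: w)) : a ∈ ({α, p, q} : Finset σ) := by
  rw [Finset.mem_insert]
  by_cases ha : p < a
  · have := h.2.2
    simp only [List.filter_cons, ha, decide_true, if_true, List.cons.injEq] at this
    exact Or.inl this.1
  · exact Or.inr (h.2.1 a List.mem_cons_self (not_lt.1 ha))

theorem head_mem_of_cons_mem_sortedShuffles_nil {a : σ} {l : List σ}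
    (h : a :: l ∈ sortedShuffles R q p []) : a ∈ ({p, q} : Finset σ) := by
  by_cases ha : p < a
  · have := h.2.2
    simp [ha] at this
  · exact h.2.1 a List.mem_cons_self (not_lt.1 ha)

/-- The largest of the small letters can be put in front when the large letters are sorted. -/
theorem cons_mem_shuffles_of_mem {a : σ} {w l : List σ} (ha : a ∈ T) (hap : a ≤ p)
    (hT : ∀ b ∈ T, b ≤ a) :
    a :: l ∈ shuffles R p T w ↔ w.Pairwise R ∧ l ∈ shuffles R p T w := by
  have hf : ∀ l : List σ, (∀ b ∈ l, b ≤ p → b ∈ T) → l.filter (a < ·) = l.filter (p < ·) := by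
    intro l hl
    refine List.filter_congr fun x hx => ?_
    by_cases h : p < x
    · simp [h, hap.trans_lt h]
    · simp [h, hT x (hl x hx (not_lt.1 h))]
  simp only [shuffles, Set.mem_ofPred_eq, LargerSorted, List.forall_mem_cons, List.filter_cons,
    hap.not_gt, decide_false]
  constructor
  · rintro ⟨⟨h1, h2⟩, ⟨-, h3⟩, h4⟩
    rw [hf l h3] at h1
    have h5 : l.filter (p < ·) = w := by simpa using h4
    exact ⟨h5 ▸ h1, h2, h3, h5⟩
  · rintro ⟨h1, h2, h3, h4⟩
    refine ⟨⟨?_, h2⟩, ⟨fun _ => ha, h3⟩, by simpa using h4⟩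
    rw [hf l h3, h4]
    exact h1

/-- Since q is the least letter available, the condition imposed by an initial q implies all the
later ones. -/
theorem cons_mem_shuffles_pair_of_lt {w l : List σ} (hqp : q < p) :
    q :: l ∈ shuffles R p {p, q} w ↔ l ∈ sortedShuffles R q p w := by
  simp only [shuffles, sortedShuffles, Set.mem_ofPred_eq, LargerSorted, List.forall_mem_cons,
    List.filter_cons, hqp.not_gt, decide_false]
  constructor
  · rintro ⟨⟨h1, h2⟩, ⟨-, h3⟩, h4⟩
    exact ⟨h1, h3, by simpa using h4⟩
  · rintro ⟨h1, h3, h4⟩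
    refine ⟨⟨h1, ?_⟩, ⟨fun _ => by simp, h3⟩, by simpa using h4⟩
    refine LargerSorted.of_pairwise (fun a ha => ?_) h1
    by_cases hp : a ≤ p
    · have := h3 a ha hp
      simp only [Finset.mem_insert, Finset.mem_singleton] at this
      rcases this with rfl | rfl
      · exact hqp.le
      · exact le_rfl
    · exact (hqp.trans (not_le.1 hp)).le

theorem cons_mem_sortedShuffles_right {w l : List σ} (hqp : q < p) :
    q :: l ∈ sortedShuffles R q p w ↔ l ∈ sortedShuffles R q p w := by
  simp [sortedShuffles, hqp.not_gt]

theorem pairwise_of_mem_sortedShuffles {w l : List σ} (hqp : q < p)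
    (h : l ∈ sortedShuffles R q p w) : w.Pairwise R := by
  obtain ⟨h1, -, rfl⟩ := h
  refine h1.sublist ?_
  have h1 : l.filter (p < ·) = (l.filter (q < ·)).filter (p < ·) := by
    rw [List.filter_filter]
    refine List.filter_congr fun x _ => ?_
    by_cases hx : p < x
    · simp [hx, hqp.trans hx]
    · simp [hx]
  rw [h1]
  exact List.filter_sublist

end Shuffles

/-! ### The relation for a fixed word of large letters -/

section ShuffleSeries

open MvPowerSeries (X)

variable {σ : Type*} [LinearOrder σ] {R : σ → σ → Prop} {p q : σ} {T : Finset σ}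

theorem wordGF_shuffles_cons {α : σ} {w : List σ} (hT : ∀ t ∈ T, t ≤ p)
    (h : LargerSorted R (α :: w)) (hw : p < α) :
    wordGF (shuffles R p T (α :: w)) = X α * wordGF (shuffles R p T w) +
      ∑ x ∈ T, X x * wordGF {l | x :: l ∈ shuffles R p T (α :: w)} := by
  have hα : α ∉ T := fun h => (hT α h).not_gt hw
  rw [wordGF_eq_sum_cons_of_nil_notMem (insert α T)
    (fun x l hx => head_eq_of_cons_mem_shuffles hx) (by simp [nil_mem_shuffles_iff]),
    Finset.sum_insert hα]
  congr 3
  ext l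
  simp [cons_mem_shuffles_of_lt hw h hw]

theorem wordGF_shuffles_nil :
    wordGF (shuffles R p T []) =
      1 + ∑ x ∈ T, X x * wordGF {l | x :: l ∈ shuffles R p T []} :=
  wordGF_eq_sum_cons_of_nil_mem T (fun _ _ hx => head_mem_of_cons_mem_shuffles_nil hx)
    (nil_mem_shuffles_iff.2 rfl)

theorem wordGF_setOf_cons_mem_shuffles {a : σ} {w : List σ} (ha : a ∈ T) (hap : a ≤ p)
    (hT : ∀ b ∈ T, b ≤ a) (hw : w.Pairwise R) :
    wordGF {l | a :: l ∈ shuffles R p T w} = wordGF (shuffles R p T w) := by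
  congr 1
  ext l
  simp [cons_mem_shuffles_of_mem ha hap hT, hw]

theorem wordGF_setOf_cons_mem_shuffles_eq_zero {a : σ} {w : List σ} (ha : a ∈ T) (hap : a ≤ p)
    (hT : ∀ b ∈ T, b ≤ a) (hw : ¬ w.Pairwise R) :
    wordGF {l | a :: l ∈ shuffles R p T w} = 0 := by
  rw [← wordGF_empty]
  congr 1
  ext l
  simp [cons_mem_shuffles_of_mem ha hap hT, hw]

theorem wordGF_setOf_cons_mem_shuffles_pair {w : List σ} (hqp : q < p) :
    wordGF {l | q :: l ∈ shuffles R p {p, q} w} = wordGF (sortedShuffles R q p w) := by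
  congr 1
  ext l
  simp [cons_mem_shuffles_pair_of_lt hqp]

theorem wordGF_sortedShuffles_eq_zero {w : List σ} (hqp : q < p) (hw : ¬ w.Pairwise R) :
    wordGF (sortedShuffles R q p w) = 0 := by
  rw [← wordGF_empty]
  congr 1
  ext l
  exact ⟨fun h => hw (pairwise_of_mem_sortedShuffles hqp h), fun h => h.elim⟩

theorem one_sub_X_mul_wordGF_shuffles_singleton_nil {t : σ} (ht : t ≤ p) :
    (1 - X t) * wordGF (shuffles R p {t} []) = 1 := by
  have h := wordGF_shuffles_nil (R := R) (p := p) (T := {t})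
  rw [Finset.sum_singleton, wordGF_setOf_cons_mem_shuffles (by simp) ht (by simp) (by simp)] at h
  linear_combination h

theorem one_sub_X_mul_wordGF_shuffles_singleton_cons {t α : σ} {w : List σ} (ht : t ≤ p)
    (h : LargerSorted R (α :: w)) (hw : p < α) (hR : (α :: w).Pairwise R) :
    (1 - X t) * wordGF (shuffles R p {t} (α :: w)) = X α * wordGF (shuffles R p {t} w) := by
  have h := wordGF_shuffles_cons (T := {t}) (by simpa using ht) h hw
  rw [Finset.sum_singleton, wordGF_setOf_cons_mem_shuffles (by simp) ht (by simp) hR] at h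
  linear_combination h

theorem wordGF_shuffles_singleton_cons_of_not_pairwise {t α : σ} {w : List σ} (ht : t ≤ p)
    (h : LargerSorted R (α :: w)) (hw : p < α) (hR : ¬ (α :: w).Pairwise R) :
    wordGF (shuffles R p {t} (α :: w)) = X α * wordGF (shuffles R p {t} w) := by
  have h := wordGF_shuffles_cons (T := {t}) (by simpa using ht) h hw
  rw [Finset.sum_singleton, wordGF_setOf_cons_mem_shuffles_eq_zero (by simp) ht (by simp) hR] at h
  linear_combination h

/-- The relation between words with both small letters and words with one of them, when a fixed word
of large letters is given. `hM` describes the words in which the letters above `q` are sorted. -/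
theorem mul_wordGF_shuffles_pair (hqp : q < p)
    (hM : ∀ w : List σ, (∀ a ∈ w, p < a) → w.Pairwise R →
      (1 - X p - X q) * wordGF (sortedShuffles R q p w) = (1 - X q) * wordGF (shuffles R p {q} w))
    (w : List σ) (hw : ∀ a ∈ w, p < a) (hR : LargerSorted R w) :
    (X p - X q) * (1 - X p - X q) * wordGF (shuffles R p {p, q} w) =
      X p * (1 - X p) * wordGF (shuffles R p {p} w) -
        X q * (1 - X q) * wordGF (shuffles R p {q} w) := by
  have hp : ∀ b ∈ ({p, q} : Finset σ), b ≤ p := by simp [hqp.le]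
  have hne : p ∉ ({q} : Finset σ) := by simpa using hqp.ne'
  induction w with
  | nil =>
    have h1 := one_sub_X_mul_wordGF_shuffles_singleton_nil (R := R) (le_refl p)
    have h2 := one_sub_X_mul_wordGF_shuffles_singleton_nil (R := R) hqp.le
    have h3 := wordGF_shuffles_nil (R := R) (p := p) (T := {p, q})
    rw [Finset.sum_insert hne, Finset.sum_singleton,
      wordGF_setOf_cons_mem_shuffles (by simp) le_rfl hp (by simp),
      wordGF_setOf_cons_mem_shuffles_pair hqp] at h3
    have h4 := hM [] (by simp) (by simp)
    have h5 : (1 - X p - X q) * ((1 - X p) * wordGF (shuffles R p {p, q} [])) = 1 - X p := by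
      linear_combination (1 - X p - X q) * h3 + X q * h4 + X q * h2
    -- An initial p puts the unknown series on both sides, leaving a factor 1 - X p to cancel.
    have h6 : (1 - X p : MvPowerSeries σ ℚ) ≠ 0 := left_ne_zero_of_mul_eq_one h1
    apply mul_left_cancel₀ h6
    linear_combination (X p - X q) * h5 - (1 - X p) * X p * h1 + (1 - X p) * X q * h2
  | cons α w ih =>
    have hα : p < α := hw α List.mem_cons_self
    have ih := ih (fun a ha => hw a (List.mem_cons_of_mem _ ha)) hR.2
    have h3 := wordGF_shuffles_cons (T := {p, q}) hp hR hα
    rw [Finset.sum_insert hne, Finset.sum_singleton, wordGF_setOf_cons_mem_shuffles_pair hqp] at h3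
    -- An unsorted word of large letters forces α to come first, and the relation is then inherited
    -- from w. In the sorted case p and q may come first as well.
    by_cases hP : (α :: w).Pairwise R
    · have h1 := one_sub_X_mul_wordGF_shuffles_singleton_cons le_rfl hR hα hP
      have h2 := one_sub_X_mul_wordGF_shuffles_singleton_cons hqp.le hR hα hP
      rw [wordGF_setOf_cons_mem_shuffles (by simp) le_rfl hp hP] at h3
      have h4 := hM _ hw hP
      have h6 : (1 - X p : MvPowerSeries σ ℚ) ≠ 0 := left_ne_zero_of_mul_eq_one
        (one_sub_X_mul_wordGF_shuffles_singleton_nil (R := R) (le_refl p))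
      apply mul_left_cancel₀ h6
      linear_combination (X p - X q) * (1 - X p - X q) * h3 + X α * ih + X q * (X p - X q) * h4
        - X p * (1 - X p) * h1 + X q * (1 - X q) * h2
    · rw [wordGF_setOf_cons_mem_shuffles_eq_zero (by simp) le_rfl hp hP,
        wordGF_sortedShuffles_eq_zero hqp hP] at h3
      rw [wordGF_shuffles_singleton_cons_of_not_pairwise le_rfl hR hα hP,
        wordGF_shuffles_singleton_cons_of_not_pairwise hqp.le hR hα hP]
      linear_combination (X p - X q) * (1 - X p - X q) * h3 + X α * ih

/-- Both p and q may be placed in front freely: q is not subject to the sorting, and p is least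
among the letters that are. Once the first large letter has occurred, p is excluded and only q
remains to be shuffled in. -/
theorem mul_wordGF_sortedShuffles_le (hqp : q < p) (w : List σ) (hw : ∀ a ∈ w, p < a)
    (hR : w.Pairwise (· ≤ ·)) :
    (1 - X p - X q) * wordGF (sortedShuffles (· ≤ ·) q p w) =
      (1 - X q) * wordGF (shuffles (· ≤ ·) p {q} w) := by
  have hne : p ∉ ({q} : Finset σ) := by simpa using hqp.ne'
  have hq : ∀ w : List σ, wordGF {l | q :: l ∈ sortedShuffles (· ≤ ·) q p w} =
      wordGF (sortedShuffles (· ≤ ·) q p w) := fun w => by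
    congr 1
    ext l
    exact cons_mem_sortedShuffles_right hqp
  have hp : ∀ w : List σ, wordGF {l | p :: l ∈ sortedShuffles (· ≤ ·) q p w} =
      wordGF (sortedShuffles (· ≤ ·) q p w) := fun w => by
    congr 1
    ext l
    simp only [sortedShuffles, Set.mem_ofPred_eq, List.forall_mem_cons, List.filter_cons, hqp,
      lt_irrefl, decide_true, decide_false, if_true, List.pairwise_cons]
    constructor
    · rintro ⟨⟨-, h1⟩, ⟨-, h2⟩, h3⟩
      exact ⟨h1, h2, by simpa using h3⟩
    · rintro ⟨h1, h2, h3⟩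
      refine ⟨⟨fun b hb => ?_, h1⟩, ⟨fun _ => by simp, h2⟩, by simpa using h3⟩
      simp only [List.mem_filter, decide_eq_true_eq] at hb
      by_contra hbp
      have := h2 b hb.1 (not_le.1 hbp).le
      simp only [Finset.mem_insert, Finset.mem_singleton] at this
      rcases this with rfl | rfl
      · exact hbp le_rfl
      · exact hb.2.ne rfl
  cases w with
  | nil =>
    rw [one_sub_X_mul_wordGF_shuffles_singleton_nil hqp.le]
    have h := wordGF_eq_sum_cons_of_nil_mem (A := sortedShuffles (· ≤ ·) q p []) {p, q}
      (fun _ _ hx => head_mem_of_cons_mem_sortedShuffles_nil hx)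
      (nil_mem_sortedShuffles_iff.2 rfl)
    rw [Finset.sum_insert hne, Finset.sum_singleton, hq, hp] at h
    linear_combination h
  | cons α w =>
    have hα : p < α := hw α List.mem_cons_self
    have hL : LargerSorted (· ≤ ·) (α :: w) :=
      LargerSorted.of_pairwise (b := p) (fun a ha => (hw a ha).le) (hR.filter _)
    rw [one_sub_X_mul_wordGF_shuffles_singleton_cons hqp.le hL hα hR]
    have h := wordGF_eq_sum_cons_of_nil_notMem (A := sortedShuffles (· ≤ ·) q p (α :: w)) {α, p, q}
      (fun _ _ hx => head_eq_of_cons_mem_sortedShuffles hx)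
      (by simp [nil_mem_sortedShuffles_iff])
    rw [Finset.sum_insert (by simp [hα.ne', (hqp.trans hα).ne']), Finset.sum_insert hne,
      Finset.sum_singleton, hq, hp] at h
    -- After α no p may follow, since p lies below α and above q.
    have h1 : {l | α :: l ∈ sortedShuffles (· ≤ ·) q p (α :: w)} = shuffles (· ≤ ·) p {q} w := by
      ext l
      simp only [sortedShuffles, shuffles, Set.mem_ofPred_eq, List.forall_mem_cons,
        List.filter_cons, hqp.trans hα, hα, decide_true, if_true, List.pairwise_cons,
        List.cons.injEq, true_and, List.mem_filter, decide_eq_true_eq]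
      constructor
      · rintro ⟨⟨h1, h2⟩, ⟨-, h3⟩, h4⟩
        have h5 : ∀ a ∈ l, a ≤ p → a = q := by
          intro a ha hap
          have := h3 a ha hap
          simp only [Finset.mem_insert, Finset.mem_singleton] at this
          rcases this with rfl | rfl
          · exact absurd (h1 a ⟨ha, hqp⟩) hα.not_ge
          · rfl
        refine ⟨LargerSorted.of_pairwise (fun a ha => ?_) h2, by simpa using h5, h4⟩
        by_cases hap : a ≤ p
        · exact (h5 a ha hap).ge
        · exact (hqp.trans (not_le.1 hap)).le
      · rintro ⟨-, h2, h3⟩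
        have h4 : l.filter (q < ·) = w := by
          rw [← h3]
          refine List.filter_congr fun x hx => ?_
          by_cases hxp : p < x
          · simp [hxp, hqp.trans hxp]
          · have := h2 x hx (not_lt.1 hxp)
            simp only [Finset.mem_singleton] at this
            simp [this, hqp.not_gt]
        rw [h4]
        rw [List.pairwise_cons] at hR
        refine ⟨⟨fun b hb => hR.1 b ?_, hR.2⟩, ⟨fun h => absurd h hα.not_ge, fun a ha hap => ?_⟩, h3⟩
        · rw [← h4]
          simpa using hb
        · have := h2 a ha hap
          simp only [Finset.mem_singleton] at this
          simp [this]
    rw [h1] at h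
    linear_combination h

/-- In decreasing order every p must come after all large letters. So while large letters remain,
only q or the next large letter can come first, and both sides acquire the same factor; p enters
only when w is exhausted. -/
theorem mul_wordGF_sortedShuffles_ge (hqp : q < p) (w : List σ) (hw : ∀ a ∈ w, p < a)
    (hR : w.Pairwise (· ≥ ·)) :
    (1 - X p - X q) * wordGF (sortedShuffles (· ≥ ·) q p w) =
      (1 - X q) * wordGF (shuffles (· ≥ ·) p {q} w) := by
  have hne : p ∉ ({q} : Finset σ) := by simpa using hqp.ne'
  have hq : ∀ w : List σ, wordGF {l | q :: l ∈ sortedShuffles (· ≥ ·) q p w} =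
      wordGF (sortedShuffles (· ≥ ·) q p w) := fun w => by
    congr 1
    ext l
    exact cons_mem_sortedShuffles_right hqp
  induction w with
  | nil =>
    rw [one_sub_X_mul_wordGF_shuffles_singleton_nil hqp.le]
    have h := wordGF_eq_sum_cons_of_nil_mem (A := sortedShuffles (· ≥ ·) q p []) {p, q}
      (fun _ _ hx => head_mem_of_cons_mem_sortedShuffles_nil hx)
      (nil_mem_sortedShuffles_iff.2 rfl)
    have hp : {l | p :: l ∈ sortedShuffles (· ≥ ·) q p []} = sortedShuffles (· ≥ ·) q p [] := by
      ext l
      simp only [sortedShuffles, Set.mem_ofPred_eq, List.forall_mem_cons, List.filter_cons, hqp,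
        lt_irrefl, decide_true, decide_false, if_true, List.pairwise_cons]
      constructor
      · rintro ⟨⟨-, h1⟩, ⟨-, h2⟩, h3⟩
        exact ⟨h1, h2, by simpa using h3⟩
      · rintro ⟨h1, h2, h3⟩
        refine ⟨⟨fun b hb => ?_, h1⟩, ⟨fun _ => by simp, h2⟩, by simpa using h3⟩
        rw [List.filter_eq_nil_iff] at h3
        simpa using h3 b (List.mem_of_mem_filter hb)
    rw [Finset.sum_insert hne, Finset.sum_singleton, hq, hp] at h
    linear_combination h
  | cons α w ih =>
    have hα : p < α := hw α List.mem_cons_self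
    have hL : LargerSorted (· ≥ ·) (α :: w) :=
      LargerSorted.of_pairwise (b := p) (fun a ha => (hw a ha).le) (hR.filter _)
    have ih := ih (fun a ha => hw a (List.mem_cons_of_mem _ ha)) hR.of_cons
    rw [one_sub_X_mul_wordGF_shuffles_singleton_cons hqp.le hL hα hR]
    have h := wordGF_eq_sum_cons_of_nil_notMem (A := sortedShuffles (· ≥ ·) q p (α :: w)) {α, p, q}
      (fun _ _ hx => head_eq_of_cons_mem_sortedShuffles hx)
      (by simp [nil_mem_sortedShuffles_iff])
    have h1 : {l | α :: l ∈ sortedShuffles (· ≥ ·) q p (α :: w)} =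
        sortedShuffles (· ≥ ·) q p w := by
      ext l
      simp only [sortedShuffles, Set.mem_ofPred_eq, List.forall_mem_cons,
        List.filter_cons, hqp.trans hα, hα, decide_true, if_true, List.pairwise_cons,
        List.cons.injEq, true_and, List.mem_filter, decide_eq_true_eq]
      constructor
      · rintro ⟨⟨-, h2⟩, ⟨-, h3⟩, h4⟩
        exact ⟨h2, h3, h4⟩
      · rintro ⟨h2, h3, h4⟩
        refine ⟨⟨fun b hb => ?_, h2⟩, ⟨fun h => absurd h hα.not_ge, h3⟩, h4⟩
        by_cases hbp : p < b
        · rw [List.pairwise_cons] at hR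
          refine hR.1 b ?_
          rw [← h4]
          simpa using ⟨hb.1, hbp⟩
        · exact (not_lt.1 hbp).trans hα.le
    -- The letter α is still to come and exceeds p, which contradicts decreasing order.
    have h2 : {l | p :: l ∈ sortedShuffles (· ≥ ·) q p (α :: w)} = ∅ := by
      ext l
      simp only [sortedShuffles, Set.mem_ofPred_eq, List.forall_mem_cons, List.filter_cons, hqp,
        lt_irrefl, decide_true, decide_false, if_true, List.pairwise_cons,
        Set.mem_empty_iff_false, iff_false]
      rintro ⟨⟨h2, -⟩, -, h4⟩
      have h5 : α ∈ l.filter (p < ·) := by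
        have h6 : l.filter (p < ·) = α :: w := by simpa using h4
        rw [h6]
        exact List.mem_cons_self
      have h7 := h2 α (by
        simp only [List.mem_filter, decide_eq_true_eq]
        exact ⟨List.mem_of_mem_filter h5, hqp.trans hα⟩)
      exact h7.not_gt hα
    rw [Finset.sum_insert (by simp [hα.ne', (hqp.trans hα).ne']), Finset.sum_insert hne,
      Finset.sum_singleton, hq, h1, h2, wordGF_empty] at h
    have h6 : (1 - X q : MvPowerSeries σ ℚ) ≠ 0 := left_ne_zero_of_mul_eq_one
      (one_sub_X_mul_wordGF_shuffles_singleton_nil (R := (· ≥ ·)) (le_refl q))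
    apply mul_left_cancel₀ h6
    linear_combination (1 - X p - X q) * h + X α * ih

end ShuffleSeries

/-! ### The divided-difference recurrence and its solution -/

section Recurrence

open MvPowerSeries (X)

variable {σ : Type*} [LinearOrder σ] {R : σ → σ → Prop} {p q : σ}

/-- The words over the alphabet `S` in which the larger letters after any letter are sorted. -/
def largerSortedWords (R : σ → σ → Prop) (S : Finset σ) : Set (List σ) :=
  {l | LargerSorted R l ∧ ∀ a ∈ l, a ∈ S}

theorem setOf_mem_largerSortedWords_and_filter_eq {U T : Finset σ} {w : List σ}
    (hT : ∀ t ∈ T, p < t) (hw : w ∈ largerSortedWords R T) :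
    {l | l ∈ largerSortedWords R (U ∪ T) ∧ l.filter (p < ·) = w} = shuffles R p U w := by
  ext l
  simp only [largerSortedWords, shuffles, Set.mem_ofPred_eq, and_assoc, and_congr_right_iff]
  intro _
  refine and_congr_left fun h => ?_
  subst h
  refine forall₂_congr fun a ha => ?_
  rw [Finset.mem_union]
  constructor
  · rintro (h | h) hap
    · exact h
    · exact absurd hap (hT a h).not_ge
  · intro h
    by_cases hap : a ≤ p
    · exact Or.inl (h hap)
    · exact Or.inr (hw.2 a (by simpa [ha] using hap))

theorem setOf_mem_largerSortedWords_and_filter_eq_empty {U T : Finset σ} {w : List σ}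
    (hU : ∀ u ∈ U, u ≤ p) (hw : w ∉ largerSortedWords R T) :
    {l | l ∈ largerSortedWords R (U ∪ T) ∧ l.filter (p < ·) = w} = ∅ := by
  rw [Set.eq_empty_iff_forall_notMem]
  rintro l ⟨⟨h1, h2⟩, rfl⟩
  refine hw ⟨h1.filter _, fun a ha => ?_⟩
  rw [List.mem_filter] at ha
  rcases Finset.mem_union.1 (h2 a ha.1) with h | h
  · exact absurd (hU a h) (by simpa using ha.2)
  · exact h

/-- Words are sorted by the subword of their letters above p. In a fixed coefficient only finitely
many subwords occur, so the relation for one subword can be summed. -/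
theorem mul_wordGF_largerSortedWords [Finite σ] {T : Finset σ} (hqp : q < p)
    (hT : ∀ t ∈ T, p < t)
    (hM : ∀ w : List σ, (∀ a ∈ w, p < a) → w.Pairwise R →
      (1 - X p - X q) * wordGF (sortedShuffles R q p w) = (1 - X q) * wordGF (shuffles R p {q} w)) :
    (X p - X q) * (1 - X p - X q) * wordGF (largerSortedWords R ({p, q} ∪ T)) =
      X p * (1 - X p) * wordGF (largerSortedWords R ({p} ∪ T)) -
        X q * (1 - X q) * wordGF (largerSortedWords R ({q} ∪ T)) := by
  classical
  ext e
  set n := Multiset.card (Finsupp.toMultiset e)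
  have hW : ∀ w : List σ, w.length ≤ n → w ∈ (List.finite_length_le σ n).toFinset := by
    simp
  have hf : ∀ l : List σ, (l.filter (p < ·)).length ≤ l.length := fun l => List.length_filter_le _ l
  rw [map_sub, coeff_mul_wordGF_eq_sum _ _ _ hf e _ hW, coeff_mul_wordGF_eq_sum _ _ _ hf e _ hW,
    coeff_mul_wordGF_eq_sum _ _ _ hf e _ hW, ← Finset.sum_sub_distrib]
  refine Finset.sum_congr rfl fun w _ => ?_
  have h1 : ∀ u ∈ ({p, q} : Finset σ), u ≤ p := by simp [hqp.le]
  have h2 : ∀ u ∈ ({p} : Finset σ), u ≤ p := by simp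
  have h3 : ∀ u ∈ ({q} : Finset σ), u ≤ p := by simp [hqp.le]
  rw [← map_sub]
  congr 1
  by_cases hw : w ∈ largerSortedWords R T
  · rw [setOf_mem_largerSortedWords_and_filter_eq hT hw,
      setOf_mem_largerSortedWords_and_filter_eq hT hw,
      setOf_mem_largerSortedWords_and_filter_eq hT hw]
    exact mul_wordGF_shuffles_pair hqp hM w (fun a ha => hT a (hw.2 a ha)) hw.1
  · rw [setOf_mem_largerSortedWords_and_filter_eq_empty h1 hw,
      setOf_mem_largerSortedWords_and_filter_eq_empty h2 hw,
      setOf_mem_largerSortedWords_and_filter_eq_empty h3 hw]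
    simp [wordGF_empty]

theorem one_sub_X_mul_wordGF_largerSortedWords_singleton (p : σ) :
    (1 - X p) * wordGF (largerSortedWords R {p}) = 1 := by
  refine Eq.trans ?_ (one_sub_X_mul_wordGF_shuffles_singleton_nil (R := R) (le_refl p))
  congr 2
  ext l
  simp only [largerSortedWords, shuffles, Set.mem_ofPred_eq, and_congr_right_iff,
    Finset.mem_singleton, List.filter_eq_nil_iff, decide_eq_true_eq, not_lt]
  intro _
  exact ⟨fun h => ⟨fun a ha _ => h a ha, fun a ha => (h a ha).le⟩,
    fun h a ha => h.1 a ha (h.2 a ha)⟩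

/-- The divided-difference recurrence. -/
theorem sub_mul_sum_prod_div_sub {K : Type*} [Field K] (c y : σ → K) {T : Finset σ}
    (hp : p ∉ T) (hq : q ∉ T) (hpq : p ≠ q) (hy : Function.Injective y) :
    (y p - y q) * ∑ i ∈ {p, q} ∪ T, c i * ∏ j ∈ ({p, q} ∪ T).erase i, y i / (y i - y j) =
      y p * ∑ i ∈ {p} ∪ T, c i * ∏ j ∈ ({p} ∪ T).erase i, y i / (y i - y j) -
        y q * ∑ i ∈ {q} ∪ T, c i * ∏ j ∈ ({q} ∪ T).erase i, y i / (y i - y j) := by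
  have e1 : ({p, q} ∪ T : Finset σ) = insert p (insert q T) := by ext; simp
  have hp' : p ∉ insert q T := by simp [hp, hpq]
  have hq' : q ∉ insert p T := by simp [hq, hpq.symm]
  have hne : ∀ {a b : σ}, a ≠ b → y a - y b ≠ 0 := fun h => sub_ne_zero.2 (hy.ne h)
  have e2 : (insert p (insert q T)).erase q = insert p T := by
    rw [Finset.insert_comm, Finset.erase_insert hq']
  rw [e1, Finset.singleton_union, Finset.singleton_union, Finset.sum_insert hp',
    Finset.sum_insert hq, Finset.sum_insert hp, Finset.sum_insert hq, Finset.erase_insert hp',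
    Finset.erase_insert hp, Finset.erase_insert hq, e2, Finset.prod_insert hq,
    Finset.prod_insert hp]
  -- For i outside {p, q} this is the partial fraction identity (y_p - y_q) y_i² / ((y_i - y_p)(y_i
  -- - y_q)) = y_p y_i / (y_i - y_p) - y_q y_i / (y_i - y_q). The terms i = p and i = q lose one
  -- factor each, by `h3` and `h4`.
  have h1 : ∀ i ∈ T, (y p - y q) *
      (c i * ∏ j ∈ (insert p (insert q T)).erase i, y i / (y i - y j)) =
      y p * (c i * ∏ j ∈ (insert p T).erase i, y i / (y i - y j)) -
        y q * (c i * ∏ j ∈ (insert q T).erase i, y i / (y i - y j)) := by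
    intro i hi
    have hip : i ≠ p := fun h => hp (h ▸ hi)
    have hiq : i ≠ q := fun h => hq (h ▸ hi)
    rw [Finset.erase_insert_of_ne hip.symm, Finset.erase_insert_of_ne hiq.symm,
      Finset.erase_insert_of_ne hip.symm, Finset.prod_insert (by simp [hp, hpq]),
      Finset.prod_insert (by simp [hq]), Finset.prod_insert (by simp [hp])]
    field_simp [hne hip, hne hiq]
    ring
  have h2 := Finset.sum_congr rfl h1
  rw [Finset.sum_sub_distrib, ← Finset.mul_sum, ← Finset.mul_sum, ← Finset.mul_sum] at h2
  have h3 : (y p - y q) * (y p / (y p - y q)) = y p := mul_div_cancel₀ _ (hne hpq)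
  have h4 : (y p - y q) * (y q / (y q - y p)) = - y q := by
    rw [← neg_sub (y q) (y p), neg_mul, mul_div_cancel₀ _ (hne hpq.symm)]
  linear_combination h2 + c p * (∏ j ∈ T, y p / (y p - y j)) * h3 +
    c q * (∏ j ∈ T, y q / (y q - y j)) * h4

/-- Induction on the size of the alphabet: removing either of the two smallest letters gives the
smaller alphabets of the recurrence. Injectivity of the y_i makes its leading coefficient y_p - y_q
invertible in the field. -/
theorem map_wordGF_largerSortedWords [Finite σ] {K : Type*} [Field K]
    (hM : ∀ q p : σ, q < p → ∀ w : List σ, (∀ a ∈ w, p < a) → w.Pairwise R →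
      (1 - X p - X q) * wordGF (sortedShuffles R q p w) = (1 - X q) * wordGF (shuffles R p {q} w))
    (φ : MvPowerSeries σ ℚ →+* K)
    (hφ : Function.Injective fun i : σ => φ (X i) * (1 - φ (X i)))
    (S : Finset σ) (hS : S.Nonempty) :
    φ (wordGF (largerSortedWords R S)) =
      ∑ i ∈ S, (1 - φ (X i))⁻¹ * ∏ j ∈ S.erase i, φ (X i) * (1 - φ (X i)) /
        (φ (X i) * (1 - φ (X i)) - φ (X j) * (1 - φ (X j))) := by
  induction hn : S.card using Nat.strong_induction_on generalizing S with
  | h n ih =>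
    set q := S.min' hS
    have hqS : q ∈ S := S.min'_mem hS
    by_cases hS' : (S.erase q).Nonempty
    · set p := (S.erase q).min' hS'
      have hpS : p ∈ S.erase q := (S.erase q).min'_mem hS'
      set T := (S.erase q).erase p
      have hqp : q < p := lt_of_le_of_ne (S.min'_le p (Finset.mem_of_mem_erase hpS))
        (Finset.ne_of_mem_erase hpS).symm
      have hT : ∀ t ∈ T, p < t := fun t ht =>
        lt_of_le_of_ne ((S.erase q).min'_le t (Finset.mem_of_mem_erase ht))
          (Finset.ne_of_mem_erase ht).symm
      have hpT : p ∉ T := fun h => (hT p h).false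
      have hqT : q ∉ T := fun h => ((hT q h).trans hqp).false
      have hST : S = {p, q} ∪ T := by
        have h1 : insert p T = S.erase q := Finset.insert_erase hpS
        have h2 : insert q (S.erase q) = S := Finset.insert_erase hqS
        rw [← h2, ← h1]
        ext; simp; tauto
      have hcard : S.card = T.card + 2 := by
        rw [hST, Finset.union_comm, ← Finset.card_pair hqp.ne', Finset.card_union_of_disjoint]
        rw [Finset.disjoint_right]
        simp [hpT, hqT]
      have hp1 := ih (T.card + 1) (by omega) ({p} ∪ T) (by simp)
        (by rw [Finset.singleton_union, Finset.card_insert_of_notMem hpT])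
      have hq1 := ih (T.card + 1) (by omega) ({q} ∪ T) (by simp)
        (by rw [Finset.singleton_union, Finset.card_insert_of_notMem hqT])
      have h1 := congrArg φ (mul_wordGF_largerSortedWords hqp hT (hM q p hqp))
      have h2 := sub_mul_sum_prod_div_sub (fun i => (1 - φ (X i))⁻¹) _ hpT hqT hqp.ne' hφ
      simp only [map_mul, map_sub, map_one] at h1
      rw [hp1, hq1, ← hST] at h1
      rw [← hST] at h2
      have h3 : φ (X p) * (1 - φ (X p)) - φ (X q) * (1 - φ (X q)) ≠ 0 :=
        sub_ne_zero.2 (hφ.ne hqp.ne')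
      apply mul_left_cancel₀ h3
      refine Eq.trans ?_ h2.symm
      rw [← h1]
      ring
    · have h1 : S = {q} := by
        rw [Finset.not_nonempty_iff_eq_empty, Finset.erase_eq_empty_iff] at hS'
        exact hS'.resolve_left hS.ne_empty
      rw [h1]
      have h2 := congrArg φ (one_sub_X_mul_wordGF_largerSortedWords_singleton (R := R) q)
      rw [map_mul, map_sub, map_one] at h2
      simp only [Finset.sum_singleton, Finset.erase_singleton, Finset.prod_empty, mul_one]
      exact eq_inv_of_mul_eq_one_right h2

end Recurrence

/-! ### Reduction of all six patterns to `123` and `132` -/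

section Patterns

variable {α : Type*} [LinearOrder α]

theorem containsPattern_iff (π : Equiv.Perm (Fin 3)) (l : List α) :
    ContainsPattern π l ↔ ∃ x : Fin 3 → α, [x 0, x 1, x 2].Sublist l ∧
      x (π.symm 0) < x (π.symm 1) ∧ x (π.symm 1) < x (π.symm 2) := by
  have key : ∀ x : Fin 3 → α, (∀ a b, x a < x b ↔ π a < π b) ↔
      (x (π.symm 0) < x (π.symm 1) ∧ x (π.symm 1) < x (π.symm 2)) := by
    intro x
    constructor
    · intro h
      simp [h]
    · rintro ⟨h1, h2⟩ a b
      have hm : StrictMono (fun i => x (π.symm i)) := by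
        rw [Fin.strictMono_iff_lt_succ]
        intro i
        fin_cases i
        · exact h1
        · exact h2
      simpa using hm.lt_iff_lt (a := π a) (b := π b)
  constructor
  · rintro ⟨e, he, h⟩
    refine ⟨fun i => l.get (e i), ?_, (key _).1 h⟩
    rw [List.sublist_iff_exists_fin_orderEmbedding_get_eq]
    refine ⟨OrderEmbedding.ofStrictMono e he, fun i => ?_⟩
    change Fin 3 at i
    fin_cases i <;> rfl
  · rintro ⟨x, hx, h⟩
    rw [List.sublist_iff_exists_fin_orderEmbedding_get_eq] at hx
    obtain ⟨f, hf⟩ := hx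
    have hx : x = fun i : Fin 3 => l.get (f i) := by
      funext i
      rw [← hf]
      fin_cases i <;> rfl
    refine ⟨f, f.strictMono, ?_⟩
    have := (key x).2 h
    rw [hx] at this
    exact this

theorem avoidsPattern_iff (π : Equiv.Perm (Fin 3)) (l : List α) :
    AvoidsPattern π l ↔ ∀ x : Fin 3 → α, [x 0, x 1, x 2].Sublist l →
      ¬ (x (π.symm 0) < x (π.symm 1) ∧ x (π.symm 1) < x (π.symm 2)) := by
  rw [AvoidsPattern, containsPattern_iff]
  push Not
  rfl

theorem avoidsPattern_map {β : Type*} [LinearOrder β] {f : β → α} (hf : StrictMono f)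
    (π : Equiv.Perm (Fin 3)) (l : List β) :
    AvoidsPattern π (l.map f) ↔ AvoidsPattern π l := by
  rw [avoidsPattern_iff, avoidsPattern_iff]
  constructor
  · intro h x hx
    have := h (f ∘ x) (hx.map f)
    simpa [hf.lt_iff_lt] using this
  · intro h x hx
    obtain ⟨l', hl', h2⟩ := List.sublist_map_iff.1 hx
    match l', hl', h2 with
    | [], _, h2 | [_], _, h2 | [_, _], _, h2 | _ :: _ :: _ :: _ :: _, _, h2 => simp at h2
    | [a, b, c], hl', h2 =>
      simp only [List.map_cons, List.map_nil, List.cons.injEq, and_true] at h2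
      have h3 : x = f ∘ ![a, b, c] := by
        funext i
        fin_cases i
        · exact h2.1
        · exact h2.2.1
        · exact h2.2.2
      have := h ![a, b, c] hl'
      rw [h3]
      simpa [hf.lt_iff_lt] using this

theorem largerSorted_iff {R : α → α → Prop} {l : List α} :
    LargerSorted R l ↔ ∀ x : Fin 3 → α, [x 0, x 1, x 2].Sublist l →
      x 0 < x 1 → x 0 < x 2 → R (x 1) (x 2) := by
  induction l with
  | nil => simp [LargerSorted]
  | cons a l ih =>
    rw [LargerSorted, ih, List.pairwise_iff_forall_sublist]
    constructor
    · rintro ⟨h1, h2⟩ x hx h01 h02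
      rw [List.sublist_cons_iff] at hx
      rcases hx with hx | ⟨r, hr, hx⟩
      · exact h2 x hx h01 h02
      · simp only [List.cons.injEq] at hr
        obtain ⟨rfl, rfl⟩ := hr
        refine h1 ?_
        have := hx.filter (x 0 < ·)
        simpa [h01, h02] using this
    · intro h
      refine ⟨fun {b c} hbc => ?_, fun x hx => h x (hx.cons _)⟩
      have hb : b ∈ l.filter (a < ·) := hbc.subset (by simp)
      have hc : c ∈ l.filter (a < ·) := hbc.subset (by simp)
      simp only [List.mem_filter, decide_eq_true_eq] at hb hc
      exact h ![a, b, c] ((hbc.trans List.filter_sublist).cons_cons a) hb.2 hc.2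

theorem wordGF_setOf_reverse_mem {σ : Type*} (A : Set (List σ)) :
    wordGF {l | l.reverse ∈ A} = wordGF A := by
  ext e
  rw [coeff_wordGF, coeff_wordGF, ← Set.ncard_image_of_injective
    {l | l ∈ A ∧ (l : Multiset σ) = Finsupp.toMultiset e} List.reverse_injective]
  congr 2
  ext l
  simp only [Set.mem_ofPred_eq, Set.mem_image]
  constructor
  · rintro ⟨h1, h2⟩
    exact ⟨l.reverse, ⟨h1, by simpa using h2⟩, by simp⟩
  · rintro ⟨l', ⟨h1, h2⟩, rfl⟩
    exact ⟨by simpa using h1, by simpa using h2⟩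

/-- The order with all comparisons reversed. -/
abbrev dualLinearOrder (α : Type*) [LinearOrder α] : LinearOrder α :=
  inferInstanceAs (LinearOrder αᵒᵈ)

theorem avoidsPattern_dual (π : Equiv.Perm (Fin 3)) (l : List α) :
    @AvoidsPattern α (dualLinearOrder α) π l ↔ AvoidsPattern (π.trans Fin.revPerm) l := by
  refine (@avoidsPattern_iff α (dualLinearOrder α) π l).trans
    (Iff.trans ?_ (avoidsPattern_iff _ l).symm)
  refine forall₂_congr fun x _ => not_congr ?_
  have h0 : (Fin.rev (0 : Fin 3)) = 2 := rfl
  have h1 : (Fin.rev (1 : Fin 3)) = 1 := rfl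
  have h2 : (Fin.rev (2 : Fin 3)) = 0 := rfl
  simp only [Equiv.symm_trans_apply, Fin.revPerm_symm, Fin.revPerm_apply, h0, h1, h2]
  rw [and_comm]
  rfl

theorem avoidsPattern_reverse (π : Equiv.Perm (Fin 3)) (l : List α) :
    AvoidsPattern π l.reverse ↔ AvoidsPattern (Fin.revPerm.trans π) l := by
  rw [avoidsPattern_iff, avoidsPattern_iff]
  have h0 : (Fin.rev (0 : Fin 3)) = 2 := rfl
  have h1 : (Fin.rev (1 : Fin 3)) = 1 := rfl
  have h2 : (Fin.rev (2 : Fin 3)) = 0 := rfl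
  constructor
  · intro h x hx
    have := h (fun i => x (Fin.rev i)) (by rw [List.reverse_sublist.symm]; simpa [h0, h1, h2] using hx)
    simpa using this
  · intro h x hx
    have := h (fun i => x (Fin.rev i)) (by
      rw [List.reverse_sublist.symm] at hx; simpa [h0, h1, h2] using hx)
    simpa using this

theorem setOf_avoidsPattern_refl [Fintype α] :
    {l : List α | AvoidsPattern (Equiv.refl _) l} = largerSortedWords (· ≥ ·) Finset.univ := by
  ext l
  simp only [largerSortedWords, Set.mem_ofPred_eq, Finset.mem_univ, implies_true, and_true,
    avoidsPattern_iff, largerSorted_iff, Equiv.refl_symm, Equiv.refl_apply, not_and, not_lt]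
  refine forall₂_congr fun x _ => ⟨fun h h1 _ => h h1, fun h h1 => ?_⟩
  -- The inequality between the first and the third letter is not an extra restriction: in an
  -- occurrence of the pattern it follows by transitivity.
  by_contra h2
  exact h2 (h h1 (h1.trans (not_le.1 h2)))

theorem setOf_avoidsPattern_swap [Fintype α] :
    {l : List α | AvoidsPattern (Equiv.swap 1 2) l} = largerSortedWords (· ≤ ·) Finset.univ := by
  ext l
  have h0 : Equiv.swap (1 : Fin 3) 2 0 = 0 := by decide
  simp only [largerSortedWords, Set.mem_ofPred_eq, Finset.mem_univ, implies_true, and_true,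
    avoidsPattern_iff, largerSorted_iff, Equiv.symm_swap, Equiv.swap_apply_left,
    Equiv.swap_apply_right, not_and, not_lt, h0]
  refine forall₂_congr fun x _ => ⟨fun h _ h1 => h h1, fun h h1 => ?_⟩
  by_contra h2
  exact h2 (h (h1.trans (not_le.1 h2)) h1)

/-- Each pattern comes from `123` or `132` by reversing the word or the alphabet. -/
theorem perm_fin_three_cases (π : Equiv.Perm (Fin 3)) :
    π = Equiv.refl _ ∨ π = Equiv.swap 1 2 ∨ π = Fin.revPerm.trans (Equiv.refl _) ∨
      π = Fin.revPerm.trans (Equiv.swap 1 2) ∨ π = (Equiv.swap 1 2).trans Fin.revPerm ∨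
      π = (Fin.revPerm.trans (Equiv.swap 1 2)).trans Fin.revPerm := by
  decide +revert

/-- The right-hand side does not see the order of the letters, so the formula for the reversed
alphabet is the same formula. -/
theorem map_wordGF_avoidsPattern [Fintype α] [Nonempty α] {K : Type*} [Field K]
    (φ : MvPowerSeries α ℚ →+* K)
    (hφ : Function.Injective fun i : α =>
      φ (MvPowerSeries.X i) * (1 - φ (MvPowerSeries.X i)))
    (π : Equiv.Perm (Fin 3)) :
    φ (wordGF {l : List α | AvoidsPattern π l}) =
      ∑ i, (1 - φ (MvPowerSeries.X i))⁻¹ * ∏ j ∈ Finset.univ.erase i,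
        φ (MvPowerSeries.X i) * (1 - φ (MvPowerSeries.X i)) /
        (φ (MvPowerSeries.X i) * (1 - φ (MvPowerSeries.X i)) -
          φ (MvPowerSeries.X j) * (1 - φ (MvPowerSeries.X j))) := by
  set F : K := ∑ i, (1 - φ (MvPowerSeries.X i))⁻¹ * ∏ j ∈ Finset.univ.erase i,
        φ (MvPowerSeries.X i) * (1 - φ (MvPowerSeries.X i)) /
        (φ (MvPowerSeries.X i) * (1 - φ (MvPowerSeries.X i)) -
          φ (MvPowerSeries.X j) * (1 - φ (MvPowerSeries.X j))) with hF
  -- Stated for every order on the alphabet, because it is also applied to the dual order.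
  have h132 : ∀ [LinearOrder α],
      φ (wordGF {l : List α | AvoidsPattern (Equiv.swap 1 2) l}) = F := by
    intro i
    rw [setOf_avoidsPattern_swap, hF]
    refine (map_wordGF_largerSortedWords (fun q p => mul_wordGF_sortedShuffles_le) φ hφ _
      Finset.univ_nonempty).trans ?_
    congr!
  have h123 : φ (wordGF {l : List α | AvoidsPattern (Equiv.refl _) l}) = F := by
    rw [setOf_avoidsPattern_refl]
    exact map_wordGF_largerSortedWords (fun q p => mul_wordGF_sortedShuffles_ge) φ hφ _
      Finset.univ_nonempty
  have hrev : ∀ [LinearOrder α] (π : Equiv.Perm (Fin 3)),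
      wordGF {l : List α | AvoidsPattern (Fin.revPerm.trans π) l} =
        wordGF {l : List α | AvoidsPattern π l} := fun π => by
    rw [← wordGF_setOf_reverse_mem {l : List α | AvoidsPattern π l}]
    congr 1
    ext l
    exact (avoidsPattern_reverse π l).symm
  have hdual : ∀ (π : Equiv.Perm (Fin 3)),
      wordGF {l : List α | AvoidsPattern (π.trans Fin.revPerm) l} =
        wordGF {l : List α | @AvoidsPattern α (dualLinearOrder α) π l} := fun π => by
    congr 1
    ext l
    exact (avoidsPattern_dual π l).symm
  rcases perm_fin_three_cases π with rfl | rfl | rfl | rfl | rfl | rfl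
  · exact h123
  · exact h132
  · rw [hrev]; exact h123
  · rw [hrev]; exact h132
  · rw [hdual, @h132 (dualLinearOrder α)]
  · rw [hdual, @hrev (dualLinearOrder α), @h132 (dualLinearOrder α)]

end Patterns

/-! ### The fraction field, the substitution x_i = x^i, and truncation -/

section Specializations

theorem coe_eq_toMultiset_iff {α : Type*} [DecidableEq α] (l : List α) (a : α →₀ ℕ) :
    (l : Multiset α) = Finsupp.toMultiset a ↔ ∀ i, l.count i = a i := by
  rw [Multiset.ext]
  simp_rw [Multiset.coe_count, Finsupp.count_toMultiset]

theorem multisetGF_eq_wordGF (k : ℕ) (π : Equiv.Perm (Fin 3)) :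
    multisetGF k π = wordGF {l : List (Fin k) | AvoidsPattern π l} := by
  ext a
  rw [coeff_wordGF]
  change ((multisetAvoidCount k π a : ℕ) : ℚ) = _
  rw [multisetAvoidCount, ← Nat.card_coe_set_eq]
  congr 1
  refine Nat.card_congr (Equiv.subtypeEquivRight fun l => ?_)
  rw [← coe_eq_toMultiset_iff, and_comm]
  rfl

/-- The k - 1 numerators y_i give (x_i(1 - x_i))^(k-1), and the prefactor lowers the exponent of 1 -
x_i to k - 2. -/
theorem gRat_eq_sum_prod {K : Type*} [Field K] {k : ℕ} (hk : 1 ≤ k) (x : Fin k → K)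
    (hx : ∀ i, 1 - x i ≠ 0) :
    gRat k x = ∑ i, (1 - x i)⁻¹ * ∏ j ∈ Finset.univ.erase i,
      x i * (1 - x i) / (x i * (1 - x i) - x j * (1 - x j)) := by
  refine Finset.sum_congr rfl fun i _ => ?_
  have h1 : (1 - x i) ^ ((k : ℤ) - 2) = (1 - x i)⁻¹ * (1 - x i) ^ (k - 1) := by
    rw [← zpow_natCast, ← zpow_neg_one, ← zpow_add₀ (hx i)]
    congr 1
    omega
  have h2 : ∀ j, (x i - x j) * (1 - x i - x j) = x i * (1 - x i) - x j * (1 - x j) :=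
    fun j => by ring
  simp_rw [h1, h2]
  rw [Finset.prod_div_distrib, Finset.prod_const, Finset.card_erase_of_mem (Finset.mem_univ i),
    Finset.card_univ, Fintype.card_fin, mul_pow]
  ring

theorem map_multisetGF_eq_gRat {K : Type*} [Field K] {k : ℕ} (hk : 1 ≤ k)
    (φ : MvPowerSeries (Fin k) ℚ →+* K)
    (hφ : Function.Injective fun i : Fin k =>
      φ (MvPowerSeries.X i) * (1 - φ (MvPowerSeries.X i)))
    (hφ' : ∀ i, 1 - φ (MvPowerSeries.X i) ≠ 0) (π : Equiv.Perm (Fin 3)) :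
    φ (multisetGF k π) = gRat k fun i => φ (MvPowerSeries.X i) := by
  have : Nonempty (Fin k) := ⟨⟨0, hk⟩⟩
  rw [multisetGF_eq_wordGF, gRat_eq_sum_prod hk _ hφ', map_wordGF_avoidsPattern φ hφ]

theorem algebraMap_multisetGF_eq_gRat {k : ℕ} (hk : 1 ≤ k) (π : Equiv.Perm (Fin 3)) :
    algebraMap (MvPowerSeries (Fin k) ℚ) (FractionRing (MvPowerSeries (Fin k) ℚ))
        (multisetGF k π) =
      gRat k fun i => algebraMap (MvPowerSeries (Fin k) ℚ)
        (FractionRing (MvPowerSeries (Fin k) ℚ)) (MvPowerSeries.X i) := by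
  have hinj := IsFractionRing.injective (MvPowerSeries (Fin k) ℚ)
    (FractionRing (MvPowerSeries (Fin k) ℚ))
  refine map_multisetGF_eq_gRat hk _ ?_ ?_ π
  · intro i j hij
    simp only [← map_one (algebraMap (MvPowerSeries (Fin k) ℚ)
      (FractionRing (MvPowerSeries (Fin k) ℚ))), ← map_sub, ← map_mul] at hij
    -- The linear part of x_i - x_i² already identifies i.
    have h := congrArg (MvPowerSeries.coeff (Finsupp.single i 1)) (hinj hij)
    by_contra hne
    simp only [mul_sub, mul_one, map_sub, ← sq, MvPowerSeries.coeff_X_pow] at h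
    rw [MvPowerSeries.coeff_X, MvPowerSeries.coeff_X] at h
    simp [Finsupp.single_left_inj, hne, Finsupp.single_eq_single_iff] at h
  · intro i h
    rw [← map_one (algebraMap (MvPowerSeries (Fin k) ℚ)
      (FractionRing (MvPowerSeries (Fin k) ℚ))), ← map_sub, map_eq_zero_iff _ hinj] at h
    have := congrArg (MvPowerSeries.constantCoeff) h
    simp at this

theorem exists_map_val_add_one_eq {k : ℕ} (L : List ℕ) (h : ∀ p ∈ L, 0 < p ∧ p ≤ k) :
    ∃ l : List (Fin k), l.map (fun i : Fin k => (i : ℕ) + 1) = L := by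
  induction L with
  | nil => exact ⟨[], rfl⟩
  | cons p L ih =>
    obtain ⟨l, rfl⟩ := ih fun q hq => h q (List.mem_cons_of_mem _ hq)
    have hp := h p List.mem_cons_self
    refine ⟨⟨p - 1, by omega⟩ :: l, ?_⟩
    rw [List.map_cons, List.cons.injEq]
    exact ⟨Nat.sub_add_cancel hp.1, rfl⟩

theorem strictMono_val_add_one (k : ℕ) : StrictMono fun i : Fin k => (i : ℕ) + 1 :=
  fun _ _ h => Nat.succ_lt_succ h

theorem avoidCountLE_eq_ncard (π : Equiv.Perm (Fin 3)) (k n : ℕ) :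
    avoidCountLE π k n =
      {l : List (Fin k) | AvoidsPattern π l ∧ (l.map fun i : Fin k => (i : ℕ) + 1).sum = n}.ncard := by
  rw [avoidCountLE, ← Nat.card_coe_set_eq]
  symm
  refine Nat.card_eq_of_bijective (fun l => ⟨⟨l.1.map fun i : Fin k => (i : ℕ) + 1, ?_, l.2.2⟩, ?_, ?_⟩)
    ⟨?_, ?_⟩
  · intro p hp
    obtain ⟨i, -, rfl⟩ := List.mem_map.1 hp
    exact Nat.succ_pos _
  · intro p hp
    obtain ⟨i, -, rfl⟩ := List.mem_map.1 hp
    exact i.2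
  · exact (avoidsPattern_map (strictMono_val_add_one k) π _).2 l.2.1
  · intro l₁ l₂ h
    simp only [Subtype.mk.injEq, Composition.mk.injEq] at h
    exact Subtype.ext (List.map_injective_iff.2 (strictMono_val_add_one k).injective h)
  · rintro ⟨c, hc, ha⟩
    obtain ⟨l, hl⟩ := exists_map_val_add_one_eq c.blocks fun p hp => ⟨c.blocks_pos hp, hc p hp⟩
    refine ⟨⟨l, ?_, ?_⟩, ?_⟩
    · rwa [← avoidsPattern_map (strictMono_val_add_one k), hl]
    · rw [hl, c.blocks_sum]
    · simp only [Subtype.mk.injEq]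
      exact Composition.ext hl

theorem finite_setOf_sum_map_val_add_one_eq (k n : ℕ) :
    {l : List (Fin k) | (l.map fun i : Fin k => (i : ℕ) + 1).sum = n}.Finite := by
  refine (List.finite_length_le (Fin k) n).subset fun l hl => ?_
  simp only [Set.mem_ofPred_eq] at hl ⊢
  rw [← hl]
  simp

theorem hasSubst_X_pow_succ (k : ℕ) :
    MvPowerSeries.HasSubst (fun i : Fin k => (PowerSeries.X ^ ((i : ℕ) + 1) : ℚ⟦X⟧)) :=
  MvPowerSeries.hasSubst_of_constantCoeff_zero fun i => by
    change PowerSeries.constantCoeff (PowerSeries.X ^ ((i : ℕ) + 1) : ℚ⟦X⟧) = 0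
    simp

theorem coeff_prod_X_pow {k : ℕ} (n : ℕ) {l : List (Fin k)} {d : Fin k →₀ ℕ}
    (h : (l : Multiset (Fin k)) = Finsupp.toMultiset d) :
    PowerSeries.coeff n (d.prod fun i e => ((PowerSeries.X ^ ((i : ℕ) + 1) : ℚ⟦X⟧)) ^ e) =
      if (l.map fun i : Fin k => (i : ℕ) + 1).sum = n then 1 else 0 := by
  have h1 : (d.prod fun i e => ((PowerSeries.X ^ ((i : ℕ) + 1) : ℚ⟦X⟧)) ^ e) =
      PowerSeries.X ^ (l.map fun i : Fin k => (i : ℕ) + 1).sum := by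
    have h2 : ((l : Multiset (Fin k)).map fun i : Fin k => (PowerSeries.X ^ ((i : ℕ) + 1) : ℚ⟦X⟧)).prod =
        PowerSeries.X ^ (l.map fun i : Fin k => (i : ℕ) + 1).sum := by
      rw [Multiset.map_coe, Multiset.prod_coe]
      clear h
      induction l with
      | nil => simp
      | cons a l ih =>
        rw [List.map_cons, List.prod_cons, ih, List.map_cons, List.sum_cons, ← pow_add]
    rw [← h2, h, Finset.prod_multiset_map_count, Finsupp.toFinset_toMultiset]
    simp_rw [Finsupp.count_toMultiset]
    rfl
  rw [h1, PowerSeries.coeff_X_pow]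
  simp [eq_comm]

/-- Under the substitution a content becomes a power of x whose exponent is the sum of the parts, so
the coefficient of x^n collects the contents of the compositions of n. -/
theorem compGFLE_eq_subst (k : ℕ) (π : Equiv.Perm (Fin 3)) :
    compGFLE π k =
      MvPowerSeries.subst (fun i : Fin k => (PowerSeries.X ^ ((i : ℕ) + 1) : ℚ⟦X⟧))
        (multisetGF k π) := by
  classical
  ext n
  have hfin : {l : List (Fin k) | AvoidsPattern π l ∧
      (l.map fun i : Fin k => (i : ℕ) + 1).sum = n}.Finite :=
    (finite_setOf_sum_map_val_add_one_eq k n).subset fun l hl => hl.2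
  -- The contents of the avoiding words of sum n; these are the only ones that contribute to the
  -- coefficient.
  set D : Finset (Fin k →₀ ℕ) :=
    hfin.toFinset.image fun l : List (Fin k) => Multiset.toFinsupp (l : Multiset (Fin k)) with hD
  have hright : PowerSeries.coeff n (MvPowerSeries.subst
      (fun i : Fin k => (PowerSeries.X ^ ((i : ℕ) + 1) : ℚ⟦X⟧)) (multisetGF k π)) =
      ∑ᶠ d : Fin k →₀ ℕ, MvPowerSeries.coeff d (multisetGF k π) •
        PowerSeries.coeff n
          (d.prod fun i e => ((PowerSeries.X ^ ((i : ℕ) + 1) : ℚ⟦X⟧)) ^ e) :=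
    MvPowerSeries.coeff_subst (hasSubst_X_pow_succ k) _ _
  rw [hright, finsum_eq_sum_of_support_subset (s := D)]
  · rw [compGFLE, PowerSeries.coeff_mk, avoidCountLE_eq_ncard, Set.ncard_eq_toFinset_card _ hfin,
      Finset.card_eq_sum_card_fiberwise (t := D)
        (f := fun l : List (Fin k) => Multiset.toFinsupp (l : Multiset (Fin k)))
        (fun l hl => Finset.mem_image_of_mem _ hl), Nat.cast_sum]
    refine Finset.sum_congr rfl fun d hd => ?_
    obtain ⟨l, hl, rfl⟩ := Finset.mem_image.1 hd
    rw [Set.Finite.mem_toFinset] at hl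
    rw [coeff_prod_X_pow n (l := l) (by simp), if_pos hl.2, smul_eq_mul, mul_one,
      multisetGF_eq_wordGF, coeff_wordGF, ← Set.ncard_coe_finset]
    congr 2
    ext l'
    simp only [Finset.coe_filter, Set.Finite.mem_toFinset, Set.mem_ofPred_eq,
      EmbeddingLike.apply_eq_iff_eq, Multiset.toFinsupp_toMultiset]
    constructor
    · rintro ⟨⟨h1, -⟩, h2⟩
      exact ⟨h1, h2⟩
    · rintro ⟨h1, h2⟩
      refine ⟨⟨h1, ?_⟩, h2⟩
      rw [← hl.2]
      exact ((Multiset.coe_eq_coe.1 h2).map _).sum_eq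
  · intro d hd
    rw [Function.mem_support, smul_eq_mul] at hd
    have h1 := left_ne_zero_of_mul hd
    have h2 := right_ne_zero_of_mul hd
    rw [multisetGF_eq_wordGF, coeff_wordGF, Nat.cast_ne_zero] at h1
    obtain ⟨l, hl1, hl2⟩ := Set.nonempty_of_ncard_ne_zero h1
    rw [coeff_prod_X_pow n hl2] at h2
    have h3 : (l.map fun i : Fin k => (i : ℕ) + 1).sum = n := by
      by_contra h
      exact h2 (if_neg h)
    rw [hD, Finset.coe_image]
    refine ⟨l, ?_, ?_⟩
    · rw [Finset.mem_coe, Set.Finite.mem_toFinset]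
      exact ⟨hl1, h3⟩
    · change Multiset.toFinsupp (l : Multiset (Fin k)) = d
      rw [hl2, Finsupp.toMultiset_toFinsupp]

theorem coeff_compGF_eq_coeff_compGFLE (π : Equiv.Perm (Fin 3)) {k n : ℕ} (hn : n ≤ k) :
    PowerSeries.coeff n (compGF π) = PowerSeries.coeff n (compGFLE π k) := by
  rw [compGF, compGFLE, PowerSeries.coeff_mk, PowerSeries.coeff_mk, avoidCount, avoidCountLE]
  congr 1
  refine Nat.card_congr (Equiv.subtypeEquivRight fun c => ?_)
  exact ⟨fun h => ⟨fun p hp => (c.blocks_sum ▸ List.le_sum_of_mem hp : p ≤ n).trans hn, h⟩,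
    fun h => h.2⟩

theorem xL_eq : xL = HahnSeries.ofPowerSeries ℤ ℚ PowerSeries.X :=
  HahnSeries.ofPowerSeries_X.symm

theorem one_sub_xL_pow_ne_zero {i : ℕ} (hi : 1 ≤ i) : 1 - xL ^ i ≠ 0 := by
  rw [xL_eq, ← map_pow, ← map_one (HahnSeries.ofPowerSeries ℤ ℚ), ← map_sub]
  rw [map_ne_zero_iff _ HahnSeries.ofPowerSeries_injective]
  intro h
  have := congrArg PowerSeries.constantCoeff h
  simp [show i ≠ 0 by omega] at this

theorem one_sub_xL_pow_sub_xL_pow_ne_zero {i j : ℕ} (hi : 1 ≤ i) (hj : 1 ≤ j) :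
    1 - xL ^ i - xL ^ j ≠ 0 := by
  rw [xL_eq, ← map_pow, ← map_pow, ← map_one (HahnSeries.ofPowerSeries ℤ ℚ), ← map_sub, ← map_sub]
  rw [map_ne_zero_iff _ HahnSeries.ofPowerSeries_injective]
  intro h
  have := congrArg PowerSeries.constantCoeff h
  simp [show i ≠ 0 by omega, show j ≠ 0 by omega] at this

theorem xL_pow_sub_xL_pow_ne_zero {i j : ℕ} (hij : i ≠ j) : xL ^ i - xL ^ j ≠ 0 := by
  rw [xL_eq, ← map_pow, ← map_pow, ← map_sub]
  rw [map_ne_zero_iff _ HahnSeries.ofPowerSeries_injective]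
  intro h
  have := congrArg (PowerSeries.coeff i) h
  simp [PowerSeries.coeff_X_pow, hij] at this

theorem xL_ne_zero : xL ≠ 0 := by
  simp [xL]

theorem ofPowerSeries_compGFLE_eq_gRat {k : ℕ} (hk : 1 ≤ k) (π : Equiv.Perm (Fin 3)) :
    HahnSeries.ofPowerSeries ℤ ℚ (compGFLE π k) = gRat k fun i : Fin k => xL ^ ((i : ℕ) + 1) := by
  set φ : MvPowerSeries (Fin k) ℚ →+* ℚ⸨X⸩ := (HahnSeries.ofPowerSeries ℤ ℚ).comp
    (MvPowerSeries.substAlgHom (R := ℚ) (hasSubst_X_pow_succ k)).toRingHom with hφ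
  have hX : ∀ i, φ (MvPowerSeries.X i) = xL ^ ((i : ℕ) + 1) := fun i => by
    have h : φ (MvPowerSeries.X i) = HahnSeries.ofPowerSeries ℤ ℚ
      (MvPowerSeries.substAlgHom (R := ℚ) (hasSubst_X_pow_succ k) (MvPowerSeries.X i)) := rfl
    rw [h, MvPowerSeries.substAlgHom_X, map_pow, xL_eq]
  have hG : φ (multisetGF k π) = HahnSeries.ofPowerSeries ℤ ℚ (compGFLE π k) := by
    have h : φ (multisetGF k π) = HahnSeries.ofPowerSeries ℤ ℚ
      (MvPowerSeries.substAlgHom (R := ℚ) (hasSubst_X_pow_succ k) (multisetGF k π)) := rfl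
    rw [h, MvPowerSeries.substAlgHom_apply, compGFLE_eq_subst]
  rw [← hG, map_multisetGF_eq_gRat hk φ]
  · simp_rw [hX]
  · intro i j hij
    simp only [hX] at hij
    by_contra hne
    have h1 : (xL ^ ((i : ℕ) + 1) - xL ^ ((j : ℕ) + 1)) *
        (1 - xL ^ ((i : ℕ) + 1) - xL ^ ((j : ℕ) + 1)) = 0 := by
      linear_combination hij
    refine mul_ne_zero (xL_pow_sub_xL_pow_ne_zero ?_)
      (one_sub_xL_pow_sub_xL_pow_ne_zero (by omega) (by omega)) h1
    rw [Ne, Nat.add_right_cancel_iff, Fin.val_inj]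
    exact hne
  · intro i
    rw [hX]
    exact one_sub_xL_pow_ne_zero (by omega)

theorem xL_pow_mul_one_sub_xL_zpow (i j : ℕ) :
    xL ^ i * (1 - xL ^ ((j : ℤ) - (i : ℤ))) = xL ^ i - xL ^ j := by
  rw [mul_sub, mul_one, ← zpow_natCast, ← zpow_natCast, ← zpow_add₀ xL_ne_zero]
  congr 2
  ring

theorem gfFactor_eq (i j : ℕ) :
    gfFactor i j = xL ^ i * (1 - xL ^ i) / (xL ^ i * (1 - xL ^ i) - xL ^ j * (1 - xL ^ j)) := by
  rw [gfFactor, ← mul_div_mul_left _ _ (pow_ne_zero i xL_ne_zero), ← mul_assoc,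
    xL_pow_mul_one_sub_xL_zpow]
  congr 1
  ring

theorem ofPowerSeries_compGFLE_eq_sum {k : ℕ} (hk : 1 ≤ k) (π : Equiv.Perm (Fin 3)) :
    HahnSeries.ofPowerSeries ℤ ℚ (compGFLE π k) = ∑ i ∈ Finset.Icc 1 k,
      1 / (1 - xL ^ i) * ∏ j ∈ (Finset.Icc 1 k).erase i, gfFactor i j := by
  rw [ofPowerSeries_compGFLE_eq_gRat hk,
    gRat_eq_sum_prod hk _ fun i => one_sub_xL_pow_ne_zero (by omega)]
  have himg : Finset.Icc 1 k = Finset.univ.map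
      ⟨fun i : Fin k => (i : ℕ) + 1, (strictMono_val_add_one k).injective⟩ := by
    ext n
    simp only [Finset.mem_Icc, Finset.mem_map, Finset.mem_univ, true_and,
      Function.Embedding.coeFn_mk]
    exact ⟨fun h => ⟨⟨n - 1, by omega⟩, by simp only; omega⟩, by rintro ⟨i, rfl⟩; omega⟩
  rw [himg, Finset.sum_map]
  refine Finset.sum_congr rfl fun i _ => ?_
  rw [← Finset.map_erase, Finset.prod_map]
  simp_rw [gfFactor_eq, one_div]
  rfl

end Specializations

/-! ### x-adic convergence and passage to the limit -/

section Convergence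

open WithZero Filter Topology

theorem tendsto_laurent_iff {ι : Type*} {l : Filter ι} {f : ι → ℚ⸨X⸩} {x : ℚ⸨X⸩} :
    Tendsto f l (𝓝 x) ↔ ∀ n : ℕ, ∀ᶠ i in l, Valued.v (f i - x) ≤ exp (-(n : ℤ)) := by
  constructor
  · intro h n
    refine h (?_ : {y | Valued.v (y - x) ≤ exp (-(n : ℤ))} ∈ 𝓝 x)
    rw [Valued.mem_nhds]
    have h0 : Valued.v.restrict (HahnSeries.single (n : ℤ) (1 : ℚ) : ℚ⸨X⸩) ≠ 0 := by
      simp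
    refine ⟨Units.mk0 _ h0, fun y hy => ?_⟩
    rw [Set.mem_ofPred_eq, Units.val_mk0, Valuation.restrict_lt_iff_lt_embedding] at hy
    refine le_of_lt (hy.trans_eq ?_)
    rw [← LaurentSeries.valuation_single_zpow ℚ]
    exact MonoidWithZeroHom.ValueGroup₀.embedding_restrict₀ _
  · intro h s hs
    obtain ⟨γ, hγ⟩ := Valued.mem_nhds.1 hs
    obtain ⟨n, hn⟩ := exists_exp_neg_natCast_lt (x := MonoidWithZeroHom.ValueGroup₀.embedding γ.1)
      (by simp)
    rw [mem_map]
    filter_upwards [h n] with i hi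
    refine hγ ?_
    rw [Set.mem_ofPred_eq, Valuation.restrict_lt_iff_lt_embedding]
    exact hi.trans_lt hn

/-- Completeness of the Laurent series field: by the ultrametric inequality, closeness of all later
values to the single value at s₀ gives the Cauchy property. -/
theorem exists_tendsto_laurent {ι : Type*} {f : Finset ι → ℚ⸨X⸩}
    (h : ∀ n : ℕ, ∃ s₀, ∀ s, s₀ ⊆ s → Valued.v (f s - f s₀) ≤ exp (-(n : ℤ))) :
    ∃ x, Tendsto f atTop (𝓝 x) := by
  refine cauchy_map_iff_exists_tendsto.1 (Valued.cauchy_iff.2 ⟨inferInstance, fun γ => ?_⟩)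
  obtain ⟨n, hn⟩ := exists_exp_neg_natCast_lt (x := MonoidWithZeroHom.ValueGroup₀.embedding γ.1)
    (by simp)
  obtain ⟨s₀, hs₀⟩ := h n
  refine ⟨f '' Set.Ici s₀, image_mem_map (Ici_mem_atTop s₀), ?_⟩
  rintro _ ⟨s, hs, rfl⟩ _ ⟨t, ht, rfl⟩
  rw [Valuation.restrict_lt_iff_lt_embedding]
  refine lt_of_le_of_lt ?_ hn
  rw [← sub_sub_sub_cancel_right _ _ (f s₀)]
  exact Valuation.map_sub_le _ (hs₀ t ht) (hs₀ s hs)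

theorem valuation_prod_sub_one_le {ι : Type*} (f : ι → ℚ⸨X⸩) (s : Finset ι) {c : ℤᵐ⁰}
    (h1 : ∀ j, Valued.v (f j) ≤ 1) (h : ∀ j ∈ s, Valued.v (f j - 1) ≤ c) :
    Valued.v (∏ j ∈ s, f j - 1) ≤ c := by
  classical
  induction s using Finset.induction_on with
  | empty => simp
  | insert a s ha ih =>
    rw [Finset.prod_insert ha]
    have e : f a * ∏ j ∈ s, f j - 1 = f a * (∏ j ∈ s, f j - 1) + (f a - 1) := by ring
    rw [e]
    refine Valuation.map_add_le _ ?_ (h a (Finset.mem_insert_self a s))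
    rw [map_mul]
    exact mul_le_of_le_one_of_le (h1 a) (ih fun j hj => h j (Finset.mem_insert_of_mem hj))

/-- The partial product over s₀ factors out of the difference. Its valuation is kept in the bound,
since its smallness is what later makes the truncation error uniform in i. -/
theorem valuation_prod_sub_prod_le {ι : Type*} (f : ι → ℚ⸨X⸩) {s₀ s : Finset ι} (hs : s₀ ⊆ s)
    {c : ℤᵐ⁰} (h1 : ∀ j, Valued.v (f j) ≤ 1) (h : ∀ j, j ∉ s₀ → Valued.v (f j - 1) ≤ c) :
    Valued.v (∏ j ∈ s, f j - ∏ j ∈ s₀, f j) ≤ c * Valued.v (∏ j ∈ s₀, f j) := by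
  classical
  rw [← Finset.prod_sdiff hs, ← sub_one_mul, map_mul]
  gcongr
  exact valuation_prod_sub_one_le f _ h1 fun j hj => h j (Finset.mem_sdiff.1 hj).2

/-- Factors that are integral and tend to `1` have a convergent product. -/
theorem multipliable_laurent {ι : Type*} {f : ι → ℚ⸨X⸩} (h1 : ∀ j, Valued.v (f j) ≤ 1)
    (h : ∀ n : ℕ, ∃ s₀ : Finset ι, ∀ j, j ∉ s₀ → Valued.v (f j - 1) ≤ exp (-(n : ℤ))) :
    Multipliable f := by
  obtain ⟨x, hx⟩ := exists_tendsto_laurent (f := fun s => ∏ j ∈ s, f j) fun n => by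
    obtain ⟨s₀, hs₀⟩ := h n
    refine ⟨s₀, fun s hs => (valuation_prod_sub_prod_le f hs h1 hs₀).trans ?_⟩
    refine mul_le_of_le_one_right' ?_
    rw [map_prod]
    exact Finset.prod_le_one' fun j _ => h1 j
  exact ⟨x, by simpa [HasProd] using hx⟩

theorem valuation_tprod_sub_prod_le {ι : Type*} {f : ι → ℚ⸨X⸩} (hf : Multipliable f)
    {s₀ : Finset ι} {c : ℤᵐ⁰} (h1 : ∀ j, Valued.v (f j) ≤ 1)
    (h : ∀ j, j ∉ s₀ → Valued.v (f j - 1) ≤ c) (hc : c * Valued.v (∏ j ∈ s₀, f j) ≠ 0) :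
    Valued.v (∏' j, f j - ∏ j ∈ s₀, f j) ≤ c * Valued.v (∏ j ∈ s₀, f j) := by
  -- The bound is nonzero, so some finite product approximates the infinite one more closely than
  -- the bound.
  obtain ⟨n, hn⟩ := exists_exp_neg_natCast_lt hc
  have h2 : Tendsto (fun s => ∏ j ∈ s, f j) atTop (𝓝 (∏' j, f j)) := by
    simpa [HasProd] using hf.hasProd
  obtain ⟨s, hs1, hs2⟩ := ((tendsto_laurent_iff.1 h2 n).and (eventually_ge_atTop s₀)).exists
  rw [← sub_add_sub_cancel _ (∏ j ∈ s, f j)]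
  refine Valuation.map_add_le _ ?_ (valuation_prod_sub_prod_le f hs2 h1 h)
  rw [Valuation.map_sub_swap]
  exact hs1.trans hn.le

theorem valuation_xL_zpow (m : ℤ) : Valued.v (xL ^ m) = exp (-m) := by
  rw [xL, ← RatFunc.single_zpow, LaurentSeries.valuation_single_zpow]

theorem valuation_xL_pow (m : ℕ) : Valued.v (xL ^ m) = exp (-(m : ℤ)) := by
  rw [← valuation_xL_zpow, zpow_natCast]

theorem valuation_one_sub_xL_pow {i : ℕ} (hi : 1 ≤ i) : Valued.v (1 - xL ^ i) = 1 := by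
  apply Valuation.map_one_sub_of_lt
  rw [valuation_xL_pow, ← exp_zero, exp_lt_exp]
  omega

theorem valuation_one_sub_xL_pow_sub_xL_pow {i j : ℕ} (hi : 1 ≤ i) (hj : 1 ≤ j) :
    Valued.v (1 - xL ^ i - xL ^ j) = 1 := by
  rw [sub_sub]
  apply Valuation.map_one_sub_of_lt
  apply Valuation.map_add_lt
  · rw [valuation_xL_pow, ← exp_zero, exp_lt_exp]
    omega
  · rw [valuation_xL_pow, ← exp_zero, exp_lt_exp]
    omega

theorem valuation_one_sub_xL_zpow_of_pos {m : ℤ} (hm : 0 < m) : Valued.v (1 - xL ^ m) = 1 := by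
  apply Valuation.map_one_sub_of_lt
  rw [valuation_xL_zpow, ← exp_zero, exp_lt_exp]
  omega

theorem valuation_one_sub_xL_zpow_of_neg {m : ℤ} (hm : m < 0) :
    Valued.v (1 - xL ^ m) = exp (-m) := by
  rw [Valuation.map_sub_eq_of_lt_right, valuation_xL_zpow]
  rw [valuation_xL_zpow, map_one, ← exp_zero, exp_lt_exp]
  omega

theorem valuation_gfFactor_of_lt {i j : ℕ} (hi : 1 ≤ i) (hij : i < j) :
    Valued.v (gfFactor i j) = 1 := by
  rw [gfFactor, map_div₀, map_mul, valuation_one_sub_xL_pow hi,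
    valuation_one_sub_xL_pow_sub_xL_pow hi (hi.trans hij.le),
    valuation_one_sub_xL_zpow_of_pos (by omega)]
  simp

theorem valuation_gfFactor_of_gt {i j : ℕ} (hj : 1 ≤ j) (hij : j < i) :
    Valued.v (gfFactor i j) = exp ((j : ℤ) - i) := by
  rw [gfFactor, map_div₀, map_mul, valuation_one_sub_xL_pow (hj.trans hij.le),
    valuation_one_sub_xL_pow_sub_xL_pow (hj.trans hij.le) hj,
    valuation_one_sub_xL_zpow_of_neg (by omega), mul_one, one_div, ← exp_neg, neg_neg]

theorem valuation_gfFactor_le_one {i j : ℕ} (hi : 1 ≤ i) (hj : 1 ≤ j) (hij : j ≠ i) :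
    Valued.v (gfFactor i j) ≤ 1 := by
  rcases lt_or_gt_of_ne hij with h | h
  · rw [valuation_gfFactor_of_gt hj h, ← exp_zero, exp_le_exp]
    omega
  · exact (valuation_gfFactor_of_lt hi h).le

theorem valuation_gfFactor_sub_one_le {i j : ℕ} (hi : 1 ≤ i) (hij : i < j) :
    Valued.v (gfFactor i j - 1) ≤ exp ((i : ℤ) - j) := by
  have hd : Valued.v ((1 - xL ^ ((j : ℤ) - (i : ℤ))) * (1 - xL ^ i - xL ^ j)) = 1 := by
    rw [map_mul, valuation_one_sub_xL_pow_sub_xL_pow hi (hi.trans hij.le),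
      valuation_one_sub_xL_zpow_of_pos (by omega), one_mul]
  have hd0 : (1 - xL ^ ((j : ℤ) - (i : ℤ))) * (1 - xL ^ i - xL ^ j) ≠ 0 := by
    rw [← Valuation.ne_zero_iff Valued.v, hd]
    exact one_ne_zero
  rw [gfFactor, div_sub_one hd0, map_div₀, hd, div_one]
  have e : 1 - xL ^ i - (1 - xL ^ ((j : ℤ) - (i : ℤ))) * (1 - xL ^ i - xL ^ j) =
      xL ^ j + xL ^ ((j : ℤ) - (i : ℤ)) * (1 - xL ^ i - xL ^ j) := by ring
  rw [e]
  refine Valuation.map_add_le _ ?_ ?_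
  · rw [valuation_xL_pow, exp_le_exp]
    omega
  · rw [map_mul, valuation_xL_zpow, valuation_one_sub_xL_pow_sub_xL_pow hi (hi.trans hij.le),
      mul_one, neg_sub]

theorem multipliable_gfFactor {i : ℕ} (hi : 1 ≤ i) :
    Multipliable (fun j : {j : ℕ // 1 ≤ j ∧ j ≠ i} => gfFactor i j) := by
  refine multipliable_laurent (fun j => valuation_gfFactor_le_one hi j.2.1 j.2.2) fun n => ?_
  refine ⟨(Finset.Icc 1 (i + n)).subtype _, fun j hj => ?_⟩
  have h1 : i + n < (j : ℕ) := by
    by_contra h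
    exact hj (Finset.mem_subtype.2 (Finset.mem_Icc.2 ⟨j.2.1, not_lt.1 h⟩))
  refine (valuation_gfFactor_sub_one_le hi (by omega)).trans ?_
  rw [exp_le_exp]
  omega

theorem prod_subtype_gfFactor (i k : ℕ) :
    ∏ j ∈ (Finset.Icc 1 k).subtype (fun j => 1 ≤ j ∧ j ≠ i), gfFactor i j =
      ∏ j ∈ (Finset.Icc 1 k).erase i, gfFactor i j := by
  rw [Finset.prod_subtype_eq_prod_filter (f := fun j => gfFactor i j)]
  refine Finset.prod_congr ?_ fun _ _ => rfl
  ext j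
  simp only [Finset.mem_filter, Finset.mem_Icc, Finset.mem_erase]
  tauto

theorem gfFactor_ne_zero {i j : ℕ} (hi : 1 ≤ i) (hj : 1 ≤ j) (hij : j ≠ i) :
    gfFactor i j ≠ 0 := by
  rw [← Valuation.ne_zero_iff Valued.v]
  rcases lt_or_gt_of_ne hij with h | h
  · rw [valuation_gfFactor_of_gt hj h]
    exact exp_ne_zero
  · rw [valuation_gfFactor_of_lt hi h]
    exact one_ne_zero

/-- For i > 1 the single factor j = 1 has order i - 1, and the other factors are integral. This is
far from sharp but sufficient. -/
theorem valuation_prod_gfFactor_le {i k : ℕ} (hi : 1 ≤ i) (hk : 1 ≤ k) :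
    Valued.v (∏ j ∈ (Finset.Icc 1 k).erase i, gfFactor i j) ≤ exp (1 - (i : ℤ)) := by
  have h1 : ∀ j ∈ (Finset.Icc 1 k).erase i, Valued.v (gfFactor i j) ≤ 1 := fun j hj => by
    rw [Finset.mem_erase, Finset.mem_Icc] at hj
    exact valuation_gfFactor_le_one hi hj.2.1 hj.1
  rw [map_prod]
  rcases hi.eq_or_lt with rfl | hi'
  · rw [Nat.cast_one, sub_self, exp_zero]
    exact Finset.prod_le_one' h1
  · rw [← Finset.mul_prod_erase _ _ (a := 1)
      (Finset.mem_erase.2 ⟨hi'.ne, Finset.mem_Icc.2 ⟨le_rfl, hk⟩⟩)]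
    rw [valuation_gfFactor_of_gt le_rfl hi', Nat.cast_one]
    exact mul_le_of_le_one_right' (Finset.prod_le_one' fun j hj =>
      h1 j (Finset.mem_of_mem_erase hj))

theorem valuation_tprod_gfFactor_sub_le {i k : ℕ} (hi : 1 ≤ i) (hik : i ≤ k) :
    Valued.v (∏' j : {j : ℕ // 1 ≤ j ∧ j ≠ i}, gfFactor i j -
      ∏ j ∈ (Finset.Icc 1 k).erase i, gfFactor i j) ≤ exp (-(k : ℤ)) := by
  have h := valuation_tprod_sub_prod_le (multipliable_gfFactor hi)
    (s₀ := (Finset.Icc 1 k).subtype (fun j => 1 ≤ j ∧ j ≠ i)) (c := exp ((i : ℤ) - (k + 1)))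
    (fun j => valuation_gfFactor_le_one hi j.2.1 j.2.2) (fun j hj => ?_) ?_
  · rw [prod_subtype_gfFactor] at h
    -- The tail contributes order k + 1 - i and the partial product order i - 1; the dependence on i
    -- cancels and k remains.
    refine h.trans ((mul_le_mul_right (valuation_prod_gfFactor_le hi (hi.trans hik)) _).trans ?_)
    rw [← exp_add, exp_le_exp]
    omega
  · have h1 : k < (j : ℕ) := by
      by_contra h
      exact hj (Finset.mem_subtype.2 (Finset.mem_Icc.2 ⟨j.2.1, not_lt.1 h⟩))
    refine (valuation_gfFactor_sub_one_le hi (by omega)).trans ?_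
    rw [exp_le_exp]
    omega
  · refine mul_ne_zero exp_ne_zero ((Valuation.ne_zero_iff _).2 (Finset.prod_ne_zero_iff.2 ?_))
    exact fun j _ => gfFactor_ne_zero hi j.2.1 j.2.2

theorem valuation_tprod_gfFactor_le {i : ℕ} (hi : 1 ≤ i) :
    Valued.v (∏' j : {j : ℕ // 1 ≤ j ∧ j ≠ i}, gfFactor i j) ≤ exp (1 - (i : ℤ)) := by
  rw [← sub_add_cancel (∏' j : {j : ℕ // 1 ≤ j ∧ j ≠ i}, gfFactor i j)
    (∏ j ∈ (Finset.Icc 1 i).erase i, gfFactor i j)]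
  refine Valuation.map_add_le _ ((valuation_tprod_gfFactor_sub_le hi le_rfl).trans ?_)
    (valuation_prod_gfFactor_le hi hi)
  rw [exp_le_exp]
  omega

theorem valuation_compGF_sub_compGFLE_le (π : Equiv.Perm (Fin 3)) (k : ℕ) :
    Valued.v (HahnSeries.ofPowerSeries ℤ ℚ (compGFLE π k) -
      HahnSeries.ofPowerSeries ℤ ℚ (compGF π)) ≤ exp (-(k : ℤ)) := by
  rw [← map_sub]
  refine (LaurentSeries.intValuation_le_iff_coeff_lt_eq_zero ℚ _).2 fun n hn => ?_
  rw [map_sub, coeff_compGF_eq_coeff_compGFLE π hn.le, sub_self]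

theorem hasSum_compGF (π : Equiv.Perm (Fin 3)) :
    HasSum (fun i : {i : ℕ // 1 ≤ i} =>
        1 / (1 - xL ^ (i : ℕ)) * ∏' j : {j : ℕ // 1 ≤ j ∧ j ≠ (i : ℕ)}, gfFactor i j)
      (HahnSeries.ofPowerSeries ℤ ℚ (compGF π)) := by
  have hone : ∀ (i : ℕ) (z : ℚ⸨X⸩), 1 ≤ i → Valued.v (1 / (1 - xL ^ i) * z) = Valued.v z := by
    intro i z hi
    rw [map_mul, map_div₀, map_one, valuation_one_sub_xL_pow hi, div_one, one_mul]
  have key : Tendsto (fun s : Finset {i : ℕ // 1 ≤ i} => ∑ i ∈ s,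
      1 / (1 - xL ^ (i : ℕ)) * ∏' j : {j : ℕ // 1 ≤ j ∧ j ≠ (i : ℕ)}, gfFactor i j) atTop
      (𝓝 (HahnSeries.ofPowerSeries ℤ ℚ (compGF π))) := by
    rw [tendsto_laurent_iff]
    intro n
    -- The finite formula requires k ≥ 1, including when n = 0.
    set k := n + 1
    set s₀ : Finset {i : ℕ // 1 ≤ i} := (Finset.Icc 1 k).subtype _ with hs₀
    have hk : exp (-(k : ℤ)) ≤ exp (-(n : ℤ)) := by
      rw [exp_le_exp]
      omega
    filter_upwards [eventually_ge_atTop s₀] with s hs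
    have e1 : HahnSeries.ofPowerSeries ℤ ℚ (compGFLE π k) = ∑ i ∈ s₀,
        1 / (1 - xL ^ (i : ℕ)) * ∏ j ∈ (Finset.Icc 1 k).erase (i : ℕ), gfFactor i j := by
      rw [ofPowerSeries_compGFLE_eq_sum (by omega), hs₀, Finset.sum_subtype_eq_sum_filter
        (f := fun i => 1 / (1 - xL ^ i) * ∏ j ∈ (Finset.Icc 1 k).erase i, gfFactor i j)]
      refine Finset.sum_congr ?_ fun _ _ => rfl
      ext i
      simp only [Finset.mem_filter, Finset.mem_Icc]
      tauto
    -- Three errors are bounded separately: the terms with i > k, the truncation of the products for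
    -- i ≤ k, and the difference between f_k and f.
    rw [← sub_add_sub_cancel _ (HahnSeries.ofPowerSeries ℤ ℚ (compGFLE π k)), e1,
      ← Finset.sum_sdiff hs, add_sub_assoc, ← Finset.sum_sub_distrib, ← e1]
    refine Valuation.map_add_le _ (Valuation.map_add_le _ (Valuation.map_sum_le _ fun i hi => ?_)
      (Valuation.map_sum_le _ fun i hi => ?_))
      ((valuation_compGF_sub_compGFLE_le π k).trans hk)
    · have hki : k < (i : ℕ) := by
        by_contra h
        exact (Finset.mem_sdiff.1 hi).2
          (Finset.mem_subtype.2 (Finset.mem_Icc.2 ⟨i.2, not_lt.1 h⟩))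
      rw [hone _ _ i.2]
      refine (valuation_tprod_gfFactor_le i.2).trans ?_
      rw [exp_le_exp]
      omega
    · rw [← mul_sub, hone _ _ i.2]
      rw [hs₀, Finset.mem_subtype, Finset.mem_Icc] at hi
      exact (valuation_tprod_gfFactor_sub_le i.2 hi.2).trans hk
  simpa [HasSum] using key

end Convergence

theorem mainTheorem4 (π : Equiv.Perm (Fin 3)) :
    -- the infinite products and the infinite sum converge `x`-adically, and the sum is `f`
    ((∀ i : ℕ, 1 ≤ i → Multipliable (fun j : {j : ℕ // 1 ≤ j ∧ j ≠ i} => gfFactor i j)) ∧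
      HasSum (fun i : {i : ℕ // 1 ≤ i} =>
          1 / (1 - xL ^ (i : ℕ)) * ∏' j : {j : ℕ // 1 ≤ j ∧ j ≠ (i : ℕ)}, gfFactor i j)
        (HahnSeries.ofPowerSeries ℤ ℚ (compGF π))) ∧
    (∀ k : ℕ, 1 ≤ k →
      -- the multiset generating function is the rational function `g_k`
      (algebraMap (MvPowerSeries (Fin k) ℚ) (FractionRing (MvPowerSeries (Fin k) ℚ))
            (multisetGF k π) =
          gRat k (fun i => algebraMap (MvPowerSeries (Fin k) ℚ)
            (FractionRing (MvPowerSeries (Fin k) ℚ)) (MvPowerSeries.X i))) ∧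
      -- substituting `x_i = x ^ i` gives the generating function for parts at most `k`
      (compGFLE π k =
          MvPowerSeries.subst (fun i : Fin k => (PowerSeries.X ^ ((i : ℕ) + 1) : ℚ⟦X⟧))
            (multisetGF k π)) ∧
      (HahnSeries.ofPowerSeries ℤ ℚ (compGFLE π k) =
          gRat k (fun i : Fin k => xL ^ ((i : ℕ) + 1))) ∧
      -- which is the formula with `i` and `j` running up to `k` only
      (HahnSeries.ofPowerSeries ℤ ℚ (compGFLE π k) =
          ∑ i ∈ Finset.Icc 1 k,
            1 / (1 - xL ^ i) * ∏ j ∈ (Finset.Icc 1 k).erase i, gfFactor i j) ∧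
      -- and agrees with `f` in all degrees up to `k`
      (∀ n : ℕ, n ≤ k →
        PowerSeries.coeff n (compGF π) = PowerSeries.coeff n (compGFLE π k))) :=
  ⟨⟨fun _ hi => multipliable_gfFactor hi, hasSum_compGF π⟩, fun k hk =>
    ⟨algebraMap_multisetGF_eq_gRat hk π, compGFLE_eq_subst k π, ofPowerSeries_compGFLE_eq_gRat hk π,
      ofPowerSeries_compGFLE_eq_sum hk π, fun _ hn => coeff_compGF_eq_coeff_compGFLE π hn⟩⟩
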